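/- Let $m\ge 1$ be an integer, let $\alpha\ge 0$ be real, and let $x_1,\dots,x_m\in[0,\infty)$ be the eigenvalues of the Wishart--Laguerre ensemble, with joint density proportional to $$\prod_{1\le i<j\le m}(x_i-x_j)^2\prod_{i=1}^m x_i^{\alpha}e^{-x_i}.$$ For real $k\ge 0$ put $T_k=\sum_{i=1}^m x_i^k\ln x_i$, $R_k=\sum_{i=1}^m x_i^k$ and $T=T_1$. For random variables $X_1,\dots,X_l$ let $$\kappa_l(X_1,\dots,X_l)=\sum_{P}(-1)^{|P|-1}(|P|-1)!\prod_{p\in P}\mathbb{E}\Big[\prod_{j\in p}X_j\Big]$$ be their joint cumulant, the sum running over all set partitions $P$ of $\{1,\dots,l\}$, where $|P|$ is the number of blocks of $P$. Let $w(x)=x^{\alpha}e^{-x}$, let $L_n^{(\alpha)}$ be the generalized Laguerre polynomials, and let $$K(x,y)=\sqrt{w(x)w(y)}\sum_{n=0}^{m-1}\frac{n!}{\Gamma(n+\alpha+1)}L_n^{(\alpha)}(x)L_n^{(\alpha)}(y)$$ be the correlation kernel of the ensemble, and $$L_D(x,y)=-\frac{m!\,\sqrt{w(x)w(y)}}{2\,\Gamma(m+\alpha)}\Big(L_m^{(\alpha)}(x)L_{m-1}^{(\alpha)}(y)+L_{m-1}^{(\alpha)}(x)L_m^{(\alpha)}(y)\Big).$$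 For linear statistics $X_j=\sum_{i=1}^m f_j(x_i)$, $j=1,\dots,l$, the decoupled integral is $$D_l(X_1,\dots,X_l)=\sum_{P=\{p_1,\dots,p_i\}}(-1)^{i-1}\sum_{\sigma}\sum_{v=1}^{i}\int_{[0,\infty)^i}L_D(x_v,x_{\sigma(v)})\prod_{j=1}^{i}\prod_{s\in p_j}f_s(x_j)\prod_{\substack{1\le j\le i\\ j\ne v}}K(x_j,x_{\sigma(j)})\,dx_1\cdots dx_i,$$ where $P$ runs over all set partitions of $\{1,\dots,l\}$ and $\sigma$ over the cyclic permutations of $\{1,\dots,i\}$ (those consisting of a single cycle of length $i$). Then for every integer $l\ge 1$ and every real $k\ge 0$, all joint moments and all integrals involved converge absolutely, and $$D_l(T_k,T,\dots,T)=\sum_{i=0}^{l-1}\frac{(l-1)!}{(l-1-i)!}\Big((k+l-1-i)\,\kappa_{l-i}(T_k,T,\dots,T)+\kappa_{l-i}(R_k,T,\dots,T)\Big),$$ $$D_l(R_k,T,\dots,T)=\sum_{i=0}^{l-1}\frac{(l-1)!}{(l-1-i)!}\,(k+l-1-i)\,\kappa_{l-i}(R_k,T,\dots,T),$$ where in each $\kappa_{l-i}$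 and $D_l$ the statistic $T$ fills all arguments after the first. -/

import Mathlib

open MeasureTheory

noncomputable section

/-- The (unnormalized) joint eigenvalue density of the Wishart-Laguerre ensemble on `[0,∞)^m`:
`∏_{i<j} (x_i - x_j)² ∏_i x_i^α e^{-x_i}`. -/
def laguerreDensity (m : ℕ) (α : ℝ) (x : Fin m → ℝ) : ℝ :=
  (∏ i : Fin m, ∏ j ∈ Finset.Ioi i, (x i - x j) ^ 2) *
    ∏ i : Fin m, (x i ^ α * Real.exp (-x i))

/-- The nonnegative orthant `[0,∞)^ι`. -/
def orthant (ι : Type*) : Set (ι → ℝ) := {x | ∀ i, 0 ≤ x i}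

/-- The law of the eigenvalues `x_1, …, x_m` of the Wishart-Laguerre ensemble: the probability
measure on `[0,∞)^m` with density proportional to `laguerreDensity m α`. -/
def wishartLaguerre (m : ℕ) (α : ℝ) : Measure (Fin m → ℝ) :=
  (volume.restrict (orthant (Fin m))).withDensity fun x =>
    ENNReal.ofReal (laguerreDensity m α x / ∫ y in orthant (Fin m), laguerreDensity m α y)

/-- The linear statistic `X = ∑_i f(x_i)`. -/
def linearStatistic {m : ℕ} (f : ℝ → ℝ) (x : Fin m → ℝ) : ℝ := ∑ i, f (x i)

/-- The joint cumulant of `X_1, …, X_l` in terms of joint moments,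
`∑_{P} (-1)^{s-1} (s-1)! ∏_{p ∈ P} E[∏_{j ∈ p} X_j]`, the sum running over all set partitions `P`
of the index set, with `s` the number of blocks of `P`. -/
def jointCumulant {Ω : Type*} [MeasurableSpace Ω] (μ : Measure Ω) {l : ℕ}
    (X : Fin l → Ω → ℝ) : ℝ :=
  ∑ P : Finpartition (Finset.univ : Finset (Fin l)),
    (-1) ^ (P.parts.card - 1) * (Nat.factorial (P.parts.card - 1) : ℝ) *
      ∏ p ∈ P.parts, ∫ ω, ∏ j ∈ p, X j ω ∂μ

/-- `κ_l(X)`, the joint cumulant over the Wishart-Laguerre ensemble of the linear statistics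
`X_j = ∑_i f_j(x_i)`. -/
def kappa (m : ℕ) (α : ℝ) {l : ℕ} (f : Fin l → ℝ → ℝ) : ℝ :=
  jointCumulant (wishartLaguerre m α) fun j => linearStatistic (f j)

/-- The generalized Laguerre polynomial
`L_n^{(α)}(x) = ∑_{j=0}^n (-1)^j Γ(n+α+1) / (Γ(α+j+1) (n-j)! j!) x^j`, normalized so that
`∫_0^∞ x^α e^{-x} L_n^{(α)}(x)² dx = Γ(n+α+1)/n!`. -/
def laguerreL (n : ℕ) (α x : ℝ) : ℝ :=
  ∑ j ∈ Finset.range (n + 1),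
    (-1) ^ j * Real.Gamma (n + α + 1) /
      (Real.Gamma (α + j + 1) * Nat.factorial (n - j) * Nat.factorial j) * x ^ j

/-- The Laguerre weight `w(x) = x^α e^{-x}`. -/
def laguerreWeight (α x : ℝ) : ℝ := x ^ α * Real.exp (-x)

/-- The correlation kernel of the Wishart-Laguerre ensemble,
`K(x,y) = √(w(x)w(y)) ∑_{k=0}^{m-1} k!/Γ(k+α+1) L_k^{(α)}(x) L_k^{(α)}(y)`. -/
def laguerreKernel (m : ℕ) (α x y : ℝ) : ℝ :=
  Real.sqrt (laguerreWeight α x * laguerreWeight α y) *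
    ∑ k ∈ Finset.range m,
      (Nat.factorial k : ℝ) / Real.Gamma (k + α + 1) * (laguerreL k α x * laguerreL k α y)

/-- The decoupled kernel (for `m ≥ 1`)
`L_D(x,y) = - m! √(w(x)w(y)) / (2 Γ(m+α)) (L_m(x) L_{m-1}(y) + L_{m-1}(x) L_m(y))`. -/
def decoupledKernel (m : ℕ) (α x y : ℝ) : ℝ :=
  -((Nat.factorial m : ℝ) * Real.sqrt (laguerreWeight α x * laguerreWeight α y) /
      (2 * Real.Gamma (m + α))) *
    (laguerreL m α x * laguerreL (m - 1) α y + laguerreL (m - 1) α x * laguerreL m α y)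

/-- The integrand attached to a set partition `P` of `{1, …, l}`, a permutation `σ` of its blocks
and a distinguished block `v`; there is one variable `x_p` for each block `p` of `P`:
`L_D(x_v, x_{σ v}) ∏_p ∏_{s ∈ p} f_s(x_p) ∏_{p ≠ v} K(x_p, x_{σ p})`. -/
def decoupledIntegrand (m : ℕ) (α : ℝ) {l : ℕ} (f : Fin l → ℝ → ℝ)
    (P : Finpartition (Finset.univ : Finset (Fin l))) (σ : Equiv.Perm P.parts) (v : P.parts)
    (x : P.parts → ℝ) : ℝ :=
  decoupledKernel m α (x v) (x (σ v)) * (∏ p : P.parts, ∏ s ∈ p.1, f s (x p)) *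
    ∏ p ∈ Finset.univ.erase v, laguerreKernel m α (x p) (x (σ p))

open scoped Classical in
/-- The decoupled integral `D_l(X)` of the linear statistics `X_j = ∑_i f_j(x_i)`. The
permutation `σ` runs over the cyclic permutations (a single cycle through all blocks; the
identity if there is one block only). -/
def decoupledIntegral (m : ℕ) (α : ℝ) {l : ℕ} (f : Fin l → ℝ → ℝ) : ℝ :=
  ∑ P : Finpartition (Finset.univ : Finset (Fin l)),
    (-1) ^ (P.parts.card - 1) *
      ∑ σ ∈ Finset.univ.filter fun σ : Equiv.Perm P.parts => σ.IsCycleOn Set.univ,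
        ∑ v : P.parts, ∫ x in orthant P.parts, decoupledIntegrand m α f P σ v x

/-- All joint moments that enter the joint cumulant exist, and all the integrals that enter the
decoupled integral converge absolutely. -/
def AllIntegrable (m : ℕ) (α : ℝ) {l : ℕ} (f : Fin l → ℝ → ℝ) : Prop :=
  (∀ p : Finset (Fin l),
    Integrable (fun x => ∏ j ∈ p, linearStatistic (f j) x) (wishartLaguerre m α)) ∧
  ∀ (P : Finpartition (Finset.univ : Finset (Fin l))) (σ : Equiv.Perm P.parts) (v : P.parts),
    σ.IsCycleOn Set.univ → IntegrableOn (decoupledIntegrand m α f P σ v) (orthant P.parts)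

/-- The function `x ↦ x^k ln x` of the linear statistic `T_k`. -/
def fT (k x : ℝ) : ℝ := x ^ k * Real.log x

/-- The function `x ↦ x^k` of the linear statistic `R_k`. -/
def fR (k x : ℝ) : ℝ := x ^ k

/-- The functions `(g, x ln x, …, x ln x)` of the `l` linear statistics `(X_1, T, …, T)`, where
`T = T_1` and `X_1 = ∑_i g(x_i)`. -/
def withT (l : ℕ) (g : ℝ → ℝ) (j : Fin l) : ℝ → ℝ := if j.val = 0 then g else fT 1

end

/-! The proof is a dilation argument for the Euler operator $E=x\,d/dx$. Its main identity,
`decoupledIntegral_eq_sum_kappa`, is $D_l(X_1,\dots,X_l)=\sum_u\kappa_l(X_1,\dots,EX_u,\dots,X_l)$,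
where $EX_u$ is the linear statistic of $Ef_u$.

This identity has two ingredients. The ensemble is determinantal, so a cumulant is a signed sum,
over partitions and cyclic permutations of their blocks, of integrals of cyclic products of $K$
(`kappa_eq_sum_cyclic`). Under dilation, $\frac{d}{d\theta}K(\theta x,\theta
y)|_{\theta=1}=-L_D(x,y)-K(x,y)$ (`hasDerivAt_laguerreKernel`). Since
$\int\sum_i\partial_i(x_iG)=0$, the derivative moves from the kernels to the statistics, and the
terms $-K$ are absorbed by the divergence of the dilation field.

Dilating the joint density instead of the kernels shows that the same sum equals
$\kappa_{l+1}(R_1,X_1,\dots,X_l)$. Thus a trace inserted in a cumulant yields a decoupled integral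
of one order less (`kappa_update_trace`).

Now $E(x^k\ln x)=kx^k\ln x+x^k$ and $E(x\ln x)=x\ln x+x$. With $X=T_k$ or $R_k$, each of the $l-1$
slots holding $T$ contributes $\kappa_l(X,T,\dots,T)$ and a cumulant with one $T$ replaced by $R_1$,
which is $D_{l-1}(X,T,\dots,T)$. Hence $D_l=t_l+(l-1)D_{l-1}$ with $t_l$ explicit
(`decoupledIntegral_withT_succ`), and unrolling this recursion gives both formulas.

The combinatorics runs in the ring $\mathbb{R}[t_j]/(t_j^2)$: all joint moments are the coefficients
of one determinant over that ring (`laguerreMoment_eq_det`), and the cumulants are extracted from it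
by a recursion that determines them uniquely. -/

/-! ### The ring $\mathbb{R}[t_j]/(t_j^2)$ of set functions. -/

/-- Real-valued functions of finite subsets of `ι`, as a commutative ring under the convolution
over disjoint unions. This is the ring `ℝ[t_j : j ∈ ι]/(t_j²)`. -/
def SetFun (ι : Type*) := Finset ι → ℝ

namespace SetFun

variable {ι : Type*}

instance : AddCommGroup (SetFun ι) := inferInstanceAs (AddCommGroup (Finset ι → ℝ))

instance : Module ℝ (SetFun ι) := inferInstanceAs (Module ℝ (Finset ι → ℝ))

@[ext] theorem ext {u v : SetFun ι} (h : ∀ S, u S = v S) : u = v := funext h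

@[simp] theorem add_apply (u v : SetFun ι) (S : Finset ι) : (u + v) S = u S + v S := rfl

@[simp] theorem zero_apply (S : Finset ι) : (0 : SetFun ι) S = 0 := rfl

@[simp] theorem neg_apply (u : SetFun ι) (S : Finset ι) : (-u) S = -u S := rfl

@[simp] theorem sub_apply (u v : SetFun ι) (S : Finset ι) : (u - v) S = u S - v S := rfl

@[simp] theorem smul_apply (c : ℝ) (u : SetFun ι) (S : Finset ι) : (c • u) S = c * u S := rfl

@[simp] theorem sum_apply {κ : Type*} (s : Finset κ) (u : κ → SetFun ι) (S : Finset ι) :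
    (∑ i ∈ s, u i) S = ∑ i ∈ s, u i S :=
  Finset.sum_apply S s u

variable [DecidableEq ι]

instance : Mul (SetFun ι) := ⟨fun u v S => ∑ A ∈ S.powerset, u A * v (S \ A)⟩

/-- The set function supported at `A`, with value `1`. -/
def single (A : Finset ι) : SetFun ι := fun S => if S = A then 1 else 0

instance : One (SetFun ι) := ⟨single ∅⟩

theorem mul_apply (u v : SetFun ι) (S : Finset ι) :
    (u * v) S = ∑ A ∈ S.powerset, u A * v (S \ A) := rfl

theorem single_apply (A S : Finset ι) : single A S = if S = A then 1 else 0 := rfl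

theorem one_apply (S : Finset ι) : (1 : SetFun ι) S = if S = ∅ then 1 else 0 := rfl

protected theorem mul_comm (u v : SetFun ι) : u * v = v * u := by
  ext S
  rw [mul_apply, mul_apply]
  refine Finset.sum_nbij' (fun A => S \ A) (fun A => S \ A) ?_ ?_ ?_ ?_ ?_
  · intro A _; simp
  · intro A _; simp
  · intro A hA; simpa using hA
  · intro A hA; simpa using hA
  · intro A hA
    have : S \ (S \ A) = A := by simpa using hA
    rw [this, _root_.mul_comm]

protected theorem one_mul (u : SetFun ι) : 1 * u = u := by
  ext S
  rw [mul_apply, Finset.sum_eq_single ∅]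
  · simp [one_apply]
  · intro A _ hA; simp [one_apply, hA]
  · simp

protected theorem mul_assoc (u v w : SetFun ι) : u * v * w = u * (v * w) := by
  ext S
  simp only [mul_apply, Finset.sum_mul, Finset.mul_sum]
  rw [Finset.sum_sigma', Finset.sum_sigma']
  -- Both sides sum over splittings of `S` into three pieces: a chain $B\subseteq A\subseteq S$
  -- corresponds to $B$ followed by $A\setminus B$.
  refine Finset.sum_nbij' (fun p => ⟨p.2, p.1 \ p.2⟩) (fun p => ⟨p.1 ∪ p.2, p.1⟩) ?_ ?_ ?_ ?_ ?_
  · rintro ⟨A, B⟩ h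
    simp only [Finset.mem_sigma, Finset.mem_powerset] at h ⊢
    exact ⟨h.2.trans h.1, Finset.sdiff_subset_sdiff h.1 le_rfl⟩
  · rintro ⟨A, B⟩ h
    simp only [Finset.mem_sigma, Finset.mem_powerset] at h ⊢
    exact ⟨Finset.union_subset h.1 (h.2.trans Finset.sdiff_subset), Finset.subset_union_left⟩
  · rintro ⟨A, B⟩ h
    simp only [Finset.mem_sigma, Finset.mem_powerset] at h
    simp [h.2]
  · rintro ⟨A, B⟩ h
    simp only [Finset.mem_sigma, Finset.mem_powerset] at h
    have hd : Disjoint B A := (Finset.subset_sdiff.1 h.2).2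
    simp [Finset.union_sdiff_left, Finset.sdiff_eq_self_of_disjoint hd]
  · rintro ⟨A, B⟩ h
    simp only [Finset.mem_sigma, Finset.mem_powerset] at h
    have : (S \ B) \ (A \ B) = S \ A := by
      ext x
      have := @h.2 x
      simp only [Finset.mem_sdiff]
      tauto
    simp only [this]
    ring

protected theorem left_distrib (u v w : SetFun ι) : u * (v + w) = u * v + u * w := by
  ext S
  simp [mul_apply, mul_add, Finset.sum_add_distrib]

instance : CommRing (SetFun ι) :=
  { (inferInstance : AddCommGroup (SetFun ι)) with
    mul := (· * ·)
    one := 1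
    mul_assoc := SetFun.mul_assoc
    mul_comm := SetFun.mul_comm
    one_mul := SetFun.one_mul
    mul_one := fun u => by rw [SetFun.mul_comm, SetFun.one_mul]
    left_distrib := SetFun.left_distrib
    right_distrib := fun u v w => by
      rw [SetFun.mul_comm, SetFun.left_distrib, SetFun.mul_comm w, SetFun.mul_comm w]
    zero_mul := fun u => by ext S; simp [mul_apply]
    mul_zero := fun u => by ext S; simp [mul_apply] }

instance : Algebra ℝ (SetFun ι) :=
  Algebra.ofModule
    (fun r x y => by ext S; simp [mul_apply, Finset.mul_sum, mul_assoc])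
    (fun r x y => by ext S; simp [mul_apply, Finset.mul_sum, mul_left_comm])

theorem eq_sum_single [Fintype ι] (u : SetFun ι) : u = ∑ A, u A • single A := by
  ext S
  rw [sum_apply, Finset.sum_eq_single_of_mem S (Finset.mem_univ S)]
  · simp [single_apply]
  · intro A _ hA
    simp [single_apply, hA.symm]

/-- Coefficients of a finite product. -/
theorem prod_apply [Fintype ι] {κ : Type*} [Fintype κ] [DecidableEq κ] (u : κ → SetFun ι)
    (S : Finset ι) :
    (∏ i, u i) S = ∑ B : κ → Finset ι, (∏ i, single (B i)) S * ∏ i, u i (B i) := by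
  have h : ∏ i, u i = ∑ B : κ → Finset ι, (∏ i, u i (B i)) • ∏ i, single (B i) := by
    calc ∏ i, u i = ∏ i, ∑ A, u i A • single A :=
          Finset.prod_congr rfl fun i _ => eq_sum_single (u i)
      _ = _ := by
          rw [Finset.prod_univ_sum]
          simp only [Fintype.piFinset_univ]
          refine Finset.sum_congr rfl fun B _ => ?_
          rw [Finset.prod_smul]
  rw [h]
  simp [mul_comm]

theorem single_mul_apply (A : Finset ι) (u : SetFun ι) (S : Finset ι) :
    (single A * u) S = if A ⊆ S then u (S \ A) else 0 := by
  rw [mul_apply]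
  simp [single_apply]

theorem single_mul_single (A B : Finset ι) :
    single A * single B = if Disjoint A B then single (A ∪ B) else 0 := by
  ext S
  rw [single_mul_apply]
  split_ifs with h1 h2 h2
  · simp only [single_apply]
    congr 1
    apply propext
    constructor
    · rintro rfl; simp [h1]
    · rintro rfl; rw [Finset.union_sdiff_left, Finset.sdiff_eq_self_of_disjoint h2.symm]
  · rw [single_apply, if_neg]
    · rfl
    · rintro rfl; exact h2 Finset.disjoint_sdiff
  · rw [single_apply, if_neg]
    rintro rfl; exact h1 Finset.subset_union_left
  · rfl

-- `single A` is the monomial $\prod_{j\in A}t_j$, and $t_j^2=0$ kills a product as soon as two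
-- factors share an index.
open scoped Classical in
theorem prod_single {κ : Type*} [DecidableEq κ] (T : Finset κ) (B : κ → Finset ι) :
    ∏ i ∈ T, single (B i) =
      if (T : Set κ).PairwiseDisjoint B then single (T.biUnion B) else 0 := by
  induction T using Finset.induction_on with
  | empty => simp; rfl
  | insert a T ha ih =>
    rw [Finset.prod_insert ha, ih]
    have hp : ((insert a T : Finset κ) : Set κ).PairwiseDisjoint B ↔
        (T : Set κ).PairwiseDisjoint B ∧ Disjoint (B a) (T.biUnion B) := by
      rw [Finset.coe_insert, Set.pairwiseDisjoint_insert_of_notMem (by simpa using ha),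
        Finset.disjoint_biUnion_right]
      rfl
    simp only [hp, Finset.biUnion_insert]
    by_cases h1 : (T : Set κ).PairwiseDisjoint B
    · simp only [h1, if_true, true_and, single_mul_single]
    · simp [h1]

/-- Evaluation at the empty set is a ring homomorphism. -/
def evalEmpty : SetFun ι →+* ℝ where
  toFun u := u ∅
  map_one' := by simp [one_apply]
  map_mul' u v := by simp [mul_apply]
  map_zero' := rfl
  map_add' _ _ := rfl

/-- Restriction to the sets that do not contain `s`. -/
def avoidFun (s : ι) (u : SetFun ι) : SetFun ι := fun S => if s ∈ S then 0 else u S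

theorem avoidFun_apply (s : ι) (u : SetFun ι) (S : Finset ι) :
    avoidFun s u S = if s ∈ S then 0 else u S := rfl

/-- Restriction to the sets that do not contain `s` is a ring homomorphism. -/
def avoid (s : ι) : SetFun ι →+* SetFun ι where
  toFun := avoidFun s
  map_one' := by
    ext S
    by_cases h : S = ∅
    · simp [avoidFun_apply, one_apply, h]
    · simp [avoidFun_apply, one_apply, h]
  map_mul' u v := by
    ext S
    by_cases h : s ∈ S
    · rw [avoidFun_apply, if_pos h, mul_apply, Finset.sum_eq_zero]
      intro A _
      by_cases hA : s ∈ A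
      · simp [avoidFun_apply, hA]
      · simp [avoidFun_apply, hA, h]
    · simp only [avoidFun_apply, h, if_false, mul_apply]
      refine Finset.sum_congr rfl fun A hA => ?_
      rw [Finset.mem_powerset] at hA
      rw [if_neg (fun h' => h (hA h')), if_neg (fun h' => h (Finset.sdiff_subset h'))]
  map_zero' := by ext S; simp [avoidFun_apply]
  map_add' u v := by ext S; by_cases h : s ∈ S <;> simp [avoidFun_apply, h]

theorem avoid_apply (s : ι) (u : SetFun ι) (S : Finset ι) :
    avoid s u S = if s ∈ S then 0 else u S := rfl

/-- The exponential-type set function `S ↦ ∏_{j ∈ S} a_j`. -/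
def expo (a : ι → ℝ) : SetFun ι := fun S => ∏ j ∈ S, a j

/-- `expo a` is $\prod_j(1+a_jt_j)=\exp\sum_j a_jt_j$, so multiplication adds exponents. This turns
a product of linear statistics into a product over the eigenvalues. -/
theorem expo_mul (a b : ι → ℝ) : expo a * expo b = expo (a + b) := by
  ext S
  simp only [expo, mul_apply, Pi.add_apply]
  rw [Finset.prod_add]

theorem prod_expo {κ : Type*} [DecidableEq κ] (T : Finset κ) (a : κ → ι → ℝ) :
    ∏ i ∈ T, expo (a i) = expo (∑ i ∈ T, a i) := by
  induction T using Finset.induction_on with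
  | empty =>
    ext S
    rw [Finset.prod_empty, Finset.sum_empty, one_apply, expo]
    simp only [Pi.zero_apply, Finset.prod_const]
    by_cases h : S = ∅
    · simp [h]
    · simp [h]
  | insert i T hi ih => rw [Finset.prod_insert hi, Finset.sum_insert hi, ih, expo_mul]

end SetFun

/-! ### The recursion between moments and cumulants. -/

section Cumulants

variable {ι : Type*} [DecidableEq ι]

/-- A triangular system over the sets containing `s` has at most one solution. -/
theorem eq_of_sum_mul_eq {M x y : Finset ι → ℝ} (hM : M ∅ = 1) (s : ι)
    (h : ∀ S, s ∈ S → ∑ p ∈ S.powerset with s ∈ p, x p * M (S \ p) =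
      ∑ p ∈ S.powerset with s ∈ p, y p * M (S \ p)) (S : Finset ι) (hS : s ∈ S) :
    x S = y S := by
  induction S using Finset.strongInduction with
  | H S ih =>
    have key := h S hS
    have hmem : S ∈ S.powerset.filter (fun p => s ∈ p) := by simp [hS]
    rw [← Finset.add_sum_erase _ _ hmem, ← Finset.add_sum_erase _ _ hmem] at key
    have : ∑ p ∈ (S.powerset.filter (fun p => s ∈ p)).erase S, x p * M (S \ p) =
        ∑ p ∈ (S.powerset.filter (fun p => s ∈ p)).erase S, y p * M (S \ p) := by
      refine Finset.sum_congr rfl fun p hp => ?_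
      simp only [Finset.mem_erase, Finset.mem_filter, Finset.mem_powerset] at hp
      rw [ih p (Finset.ssubset_iff_subset_ne.2 ⟨hp.2.1, hp.1⟩) hp.2.2]
    rw [this] at key
    simpa [hM] using key

/-- The cumulant of the set function of moments `M`. -/
noncomputable def cumulantOf (M : Finset ι → ℝ) (S : Finset ι) : ℝ :=
  ∑ P : Finpartition S,
    (-1) ^ (P.parts.card - 1) * (Nat.factorial (P.parts.card - 1) : ℝ) * ∏ p ∈ P.parts, M p

/-- The partitions of `S`, as sets of blocks. -/
def partitionSets (S : Finset ι) : Finset (Finset (Finset ι)) :=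
  (Finset.univ : Finset (Finpartition S)).image Finpartition.parts

theorem mem_partitionSets {S : Finset ι} {Q : Finset (Finset ι)} :
    Q ∈ partitionSets S ↔
      (Q : Set (Finset ι)).PairwiseDisjoint id ∧ Q.biUnion id = S ∧ ∅ ∉ Q := by
  constructor
  · intro h
    obtain ⟨P, -, rfl⟩ := Finset.mem_image.1 h
    exact ⟨P.disjoint, P.biUnion_parts, P.bot_notMem⟩
  · rintro ⟨h1, h2, h3⟩
    refine Finset.mem_image.2 ⟨⟨Q, Finset.supIndep_iff_pairwiseDisjoint.2 h1, ?_, h3⟩,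
      Finset.mem_univ _, rfl⟩
    rw [← h2, Finset.sup_eq_biUnion]

theorem sum_finpartition_eq (S : Finset ι) (F : Finset (Finset ι) → ℝ) :
    ∑ P : Finpartition S, F P.parts = ∑ Q ∈ partitionSets S, F Q := by
  rw [partitionSets, Finset.sum_image]
  intro P _ P' _ h
  exact Finpartition.ext h

/-- Exactly one block contains `s`, because blocks are disjoint and cover `S`. -/
theorem card_filter_notMem_partition {S : Finset ι} {Q : Finset (Finset ι)}
    (hQ : Q ∈ partitionSets S) {s : ι} (hs : s ∈ S) :
    (Q.filter fun b => s ∉ b).card = Q.card - 1 := by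
  rw [mem_partitionSets] at hQ
  obtain ⟨h1, h2, -⟩ := hQ
  rw [← h2, Finset.mem_biUnion] at hs
  obtain ⟨b, hb, hsb⟩ := hs
  have : Q.filter (fun b => s ∉ b) = Q.erase b := by
    ext c
    simp only [Finset.mem_filter, Finset.mem_erase]
    constructor
    · rintro ⟨hc, hsc⟩
      exact ⟨fun h => hsc (h ▸ hsb), hc⟩
    · rintro ⟨hcb, hc⟩
      refine ⟨hc, fun hsc => ?_⟩
      exact Finset.disjoint_left.1 (h1 hc hb hcb) hsc hsb
  rw [this, Finset.card_erase_of_mem hb]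

/-- Removing from a partition a block without `s` gives a partition of a proper subset. -/
theorem sum_partition_erase {S : Finset ι} {s : ι} (hs : s ∈ S) (M : Finset ι → ℝ) (a : ℕ → ℝ) :
    ∑ p ∈ (S.powerset.filter fun p => s ∈ p).erase S,
        (∑ Q ∈ partitionSets p, a Q.card * ∏ q ∈ Q, M q) * M (S \ p) =
      ∑ Q ∈ partitionSets S, ∑ _b ∈ Q.filter fun b => s ∉ b,
        a (Q.card - 1) * ∏ q ∈ Q, M q := by
  simp only [Finset.sum_mul]
  rw [Finset.sum_sigma', Finset.sum_sigma']
  -- The complement $S\setminus p$ is added as a new block, and the inverse erases it. It is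
  -- nonempty because $p\ne S$, and it avoids `s` because $s\in p$.
  refine Finset.sum_nbij' (fun x => ⟨insert (S \ x.1) x.2, S \ x.1⟩)
    (fun x => ⟨S \ x.2, x.1.erase x.2⟩) ?_ ?_ ?_ ?_ ?_
  · rintro ⟨p, Q⟩ h
    simp only [Finset.mem_sigma, Finset.mem_erase, Finset.mem_filter, Finset.mem_powerset,
      mem_partitionSets] at h ⊢
    obtain ⟨⟨hpS, hp, hsp⟩, h1, h2, h3⟩ := h
    refine ⟨⟨?_, ?_, ?_⟩, by simp, by simp [hsp]⟩
    · rw [Finset.coe_insert]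
      refine h1.insert fun q hq _ => ?_
      have : q ⊆ p := by rw [← h2]; exact Finset.subset_biUnion_of_mem id hq
      exact Finset.disjoint_of_subset_right this Finset.sdiff_disjoint
    · rw [Finset.biUnion_insert, h2]
      simpa using hp
    · rw [Finset.mem_insert, not_or]
      refine ⟨fun h => hpS (subset_antisymm hp ?_), h3⟩
      rw [← Finset.sdiff_eq_empty_iff_subset]; exact h.symm
  · rintro ⟨Q, b⟩ h
    simp only [Finset.mem_sigma, Finset.mem_erase, Finset.mem_filter, Finset.mem_powerset,
      mem_partitionSets] at h ⊢
    obtain ⟨⟨h1, h2, h3⟩, hb, hsb⟩ := h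
    have hbS : b ⊆ S := by rw [← h2]; exact Finset.subset_biUnion_of_mem id hb
    refine ⟨⟨?_, Finset.sdiff_subset, by simp [hs, hsb]⟩, ?_, ?_, ?_⟩
    · intro h
      rw [Finset.sdiff_eq_self_iff_disjoint] at h
      have : b = ∅ := Finset.disjoint_self_iff_empty _ |>.1 (Finset.disjoint_of_subset_left hbS h)
      exact h3 (this ▸ hb)
    · exact h1.subset (by simp)
    · ext x
      simp only [Finset.mem_biUnion, Finset.mem_erase, id, Finset.mem_sdiff]
      constructor
      · rintro ⟨q, ⟨hqb, hq⟩, hx⟩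
        refine ⟨by rw [← h2]; exact Finset.mem_biUnion.2 ⟨q, hq, hx⟩, fun hxb => ?_⟩
        exact Finset.disjoint_left.1 (h1 hq hb hqb) hx hxb
      · rintro ⟨hx, hxb⟩
        rw [← h2] at hx
        obtain ⟨q, hq, hxq⟩ := Finset.mem_biUnion.1 hx
        exact ⟨q, ⟨fun h => hxb (h ▸ hxq), hq⟩, hxq⟩
    · exact fun h => h3 h.2
  · rintro ⟨p, Q⟩ h
    simp only [Finset.mem_sigma, Finset.mem_erase, Finset.mem_filter, Finset.mem_powerset,
      mem_partitionSets] at h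
    obtain ⟨⟨hpS, hp, hsp⟩, h1, h2, h3⟩ := h
    have e1 : S \ (S \ p) = p := by simpa using hp
    have : S \ p ∉ Q := by
      intro hQ
      have h4 : S \ p ⊆ p := by
        conv_rhs => rw [← h2]
        exact Finset.subset_biUnion_of_mem id hQ
      have : S \ p = ∅ := by
        apply (Finset.disjoint_self_iff_empty _).1
        exact Finset.disjoint_of_subset_right h4 Finset.sdiff_disjoint
      exact h3 (this ▸ hQ)
    simp only [e1, Finset.erase_insert this]
  · rintro ⟨Q, b⟩ h
    simp only [Finset.mem_sigma, Finset.mem_filter, mem_partitionSets] at h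
    obtain ⟨⟨h1, h2, h3⟩, hb, hsb⟩ := h
    have hbS : b ⊆ S := by rw [← h2]; exact Finset.subset_biUnion_of_mem id hb
    have e1 : S \ (S \ b) = b := by simpa using hbS
    simp only [e1, Finset.insert_erase hb]
  · rintro ⟨p, Q⟩ h
    simp only [Finset.mem_sigma, Finset.mem_erase, Finset.mem_filter, Finset.mem_powerset,
      mem_partitionSets] at h
    obtain ⟨⟨hpS, hp, hsp⟩, h1, h2, h3⟩ := h
    have : S \ p ∉ Q := by
      intro hQ
      have h4 : S \ p ⊆ p := by
        conv_rhs => rw [← h2]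
        exact Finset.subset_biUnion_of_mem id hQ
      have : S \ p = ∅ := by
        apply (Finset.disjoint_self_iff_empty _).1
        exact Finset.disjoint_of_subset_right h4 Finset.sdiff_disjoint
      exact h3 (this ▸ hQ)
    simp only [Finset.card_insert_of_notMem this, Finset.prod_insert this, Nat.add_sub_cancel]
    ring

/-- The recursion between moments and cumulants. -/
theorem sum_cumulantOf_mul {M : Finset ι → ℝ} (hM : M ∅ = 1) {s : ι} {S : Finset ι}
    (hs : s ∈ S) :
    ∑ p ∈ S.powerset with s ∈ p, cumulantOf M p * M (S \ p) = M S := by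
  have hc : ∀ p, cumulantOf M p = ∑ Q ∈ partitionSets p,
      ((-1) ^ (Q.card - 1) * (Nat.factorial (Q.card - 1) : ℝ)) * ∏ q ∈ Q, M q := fun p => by
    rw [← sum_finpartition_eq p fun Q =>
      ((-1) ^ (Q.card - 1) * (Nat.factorial (Q.card - 1) : ℝ)) * ∏ q ∈ Q, M q]
    rfl
  have hmem : S ∈ S.powerset.filter (fun p => s ∈ p) := by simp [hs]
  rw [← Finset.add_sum_erase _ _ hmem]
  simp only [hc]
  rw [sum_partition_erase hs M fun n => (-1) ^ (n - 1) * (Nat.factorial (n - 1) : ℝ),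
    sdiff_self, Finset.bot_eq_empty, hM, mul_one, ← Finset.sum_add_distrib]
  have hSne : S ≠ ∅ := Finset.ne_empty_of_mem hs
  have hSp : ({S} : Finset (Finset ι)) ∈ partitionSets S := by
    rw [mem_partitionSets]
    exact ⟨by simp, by simp, by simpa using hSne.symm⟩
  rw [Finset.sum_eq_single_of_mem _ hSp]
  · simp [hs]
  -- A partition with $r\ge 2$ blocks arises once from $p=S$ and $r-1$ times by erasing a block
  -- without `s`; the weights cancel: $(-1)^{r-1}(r-1)!+(r-1)(-1)^{r-2}(r-2)!=0$. Only the partition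
  -- with the single block `S` survives.
  · intro Q hQ hne
    rw [Finset.sum_const, card_filter_notMem_partition hQ hs]
    have hcard : 2 ≤ Q.card := by
      by_contra hlt
      rw [mem_partitionSets] at hQ
      have : Q.card = 0 ∨ Q.card = 1 := by omega
      rcases this with h | h
      · rw [Finset.card_eq_zero] at h
        subst h
        exact hSne (by simpa using hQ.2.1.symm)
      · obtain ⟨b, rfl⟩ := Finset.card_eq_one.1 h
        exact hne (by simpa using hQ.2.1)
    obtain ⟨n, hn⟩ := Nat.exists_eq_add_of_le' hcard
    rw [hn]
    simp only [nsmul_eq_mul, Nat.add_sub_cancel, show n + 2 - 1 = n + 1 by omega,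
      Nat.factorial_succ, pow_succ]
    push_cast
    ring

end Cumulants

/-! ### Linearity, relabelling and derivations of cumulants. -/

section CumulantCalculus

variable {ι : Type*} [DecidableEq ι]

theorem cumulantOf_congr {M M' : Finset ι → ℝ} {S : Finset ι} (h : ∀ p ⊆ S, M p = M' p) :
    cumulantOf M S = cumulantOf M' S := by
  unfold cumulantOf
  refine Finset.sum_congr rfl fun P _ => ?_
  congr 1
  exact Finset.prod_congr rfl fun p hp => h p (P.le hp)

/-- Cumulants are linear in each slot. -/
theorem cumulantOf_linear {M M₁ M₂ : Finset ι → ℝ} (hM : M ∅ = 1) {s : ι} {a b : ℝ}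
    (h₁ : ∀ p, s ∉ p → M₁ p = M p) (h₂ : ∀ p, s ∉ p → M₂ p = M p)
    (h : ∀ p, s ∈ p → M p = a * M₁ p + b * M₂ p) {S : Finset ι} (hs : s ∈ S) :
    cumulantOf M S = a * cumulantOf M₁ S + b * cumulantOf M₂ S := by
  refine eq_of_sum_mul_eq (x := cumulantOf M)
    (y := fun S => a * cumulantOf M₁ S + b * cumulantOf M₂ S) hM s (fun S hS => ?_) S hs
  have e₁ : M₁ ∅ = 1 := by rw [h₁ _ (by simp), hM]
  have e₂ : M₂ ∅ = 1 := by rw [h₂ _ (by simp), hM]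
  rw [sum_cumulantOf_mul hM hS, h S hS, ← sum_cumulantOf_mul e₁ hS, ← sum_cumulantOf_mul e₂ hS,
    Finset.mul_sum, Finset.mul_sum, ← Finset.sum_add_distrib]
  refine Finset.sum_congr rfl fun p hp => ?_
  have hsp : s ∉ S \ p := by simp [(Finset.mem_filter.1 hp).2]
  rw [h₁ _ hsp, h₂ _ hsp]
  ring

/-- Cumulants are invariant under relabelling. -/
theorem cumulantOf_map {ι' : Type*} [DecidableEq ι'] (e : ι' ↪ ι) {M : Finset ι → ℝ}
    (hM : M ∅ = 1) {S : Finset ι'} (hS : S.Nonempty) :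
    cumulantOf (fun p => M (p.map e)) S = cumulantOf M (S.map e) := by
  obtain ⟨s, hs⟩ := hS
  refine eq_of_sum_mul_eq (M := fun p => M (p.map e)) (x := cumulantOf fun p => M (p.map e))
    (y := fun S => cumulantOf M (S.map e)) (by simpa using hM) s (fun S hS => ?_) S hs
  rw [sum_cumulantOf_mul (by simpa using hM) hS,
    ← sum_cumulantOf_mul hM (Finset.mem_map_of_mem e hS)]
  symm
  refine Finset.sum_bij (fun p _ => p.map e) ?_ ?_ ?_ ?_
  · intro p hp
    simp only [Finset.mem_filter, Finset.mem_powerset] at hp ⊢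
    exact ⟨Finset.map_subset_map.2 hp.1, Finset.mem_map_of_mem e hp.2⟩
  · intro p _ q _ h
    exact Finset.map_injective e h
  · intro q hq
    simp only [Finset.mem_filter, Finset.mem_powerset] at hq
    obtain ⟨p, hp, rfl⟩ := Finset.subset_map_iff.1 hq.1
    exact ⟨p, by simpa [hp] using hq.2, rfl⟩
  · intro p hp
    congr 2
    ext x
    simp only [Finset.mem_map, Finset.mem_sdiff]
    constructor
    · rintro ⟨y, hy, rfl⟩
      exact ⟨⟨y, hy.1, rfl⟩, by simpa using hy.2⟩
    · rintro ⟨⟨y, hy, rfl⟩, h⟩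
      exact ⟨y, ⟨hy, by simpa using h⟩, rfl⟩

/-- If `M_u`, `u ∈ ι`, are the variations of the moments `M` in the slots `u`, then the cumulants
satisfy the same variation formula: the logarithmic derivative of the moments. -/
theorem sum_variation {M : Finset ι → ℝ} (hM : M ∅ = 1) {V : ι → Finset ι → ℝ}
    (hV : ∀ u p, u ∉ p → V u p = M p) (S : Finset ι) :
    ∑ u ∈ S, V u S = ∑ p ∈ S.powerset, (∑ u ∈ p, cumulantOf (V u) p) * M (S \ p) := by
  induction S using Finset.strongInduction with
  | H S ih =>
    rcases S.eq_empty_or_nonempty with rfl | ⟨s, hs⟩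
    · simp
    have hV0 : ∀ u, V u ∅ = 1 := fun u => by rw [hV u _ (by simp), hM]
    -- Leibniz rule on the term of the block $p\ni s$: a variation at $u\in p$ leaves the moment of
    -- $S\setminus p$ alone, a variation at $u\notin p$ leaves the cumulant of $p$ alone. The second
    -- kind is covered by the induction hypothesis on $S\setminus p$.
    have key : ∀ p ∈ S.powerset.filter (fun p => s ∈ p),
        ∑ u ∈ S, cumulantOf (V u) p * V u (S \ p) =
          (∑ u ∈ p, cumulantOf (V u) p) * M (S \ p) +
            ∑ q ∈ (S \ p).powerset,
              cumulantOf M p * ((∑ u ∈ q, cumulantOf (V u) q) * M ((S \ p) \ q)) := by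
      intro p hp
      simp only [Finset.mem_filter, Finset.mem_powerset] at hp
      rw [← Finset.mul_sum, ← ih (S \ p), Finset.mul_sum, Finset.sum_mul,
        ← Finset.sum_sdiff hp.1, add_comm]
      · congr 1
        · refine Finset.sum_congr rfl fun u hu => ?_
          rw [hV u (S \ p) (by simp [hu])]
        · refine Finset.sum_congr rfl fun u hu => ?_
          rw [cumulantOf_congr fun q hq => hV u q fun h => (Finset.mem_sdiff.1 hu).2 (hq h)]
      · exact Finset.sdiff_ssubset hp.1 ⟨s, hp.2⟩
    have lhs : ∑ u ∈ S, V u S = ∑ p ∈ S.powerset with s ∈ p,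
        ∑ u ∈ S, cumulantOf (V u) p * V u (S \ p) := by
      rw [Finset.sum_comm]
      refine Finset.sum_congr rfl fun u _ => ?_
      rw [sum_cumulantOf_mul (hV0 u) hs]
    rw [lhs, Finset.sum_congr rfl key, Finset.sum_add_distrib,
      ← Finset.sum_filter_add_sum_filter_not S.powerset (fun p => s ∈ p)]
    congr 1
    rw [Finset.sum_sigma']
    -- For blocks without `s`, the remaining moment is expanded by the recursion at `s`, so that
    -- both double sums run over disjoint pairs $(p,q)$ with $s\in p$.
    have rhs : ∀ q ∈ S.powerset.filter (fun p => s ∉ p),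
        (∑ u ∈ q, cumulantOf (V u) q) * M (S \ q) =
          ∑ p ∈ (S \ q).powerset.filter (fun p => s ∈ p),
            (∑ u ∈ q, cumulantOf (V u) q) * (cumulantOf M p * M ((S \ q) \ p)) := by
      intro q hq
      rw [← Finset.mul_sum, sum_cumulantOf_mul hM (by simp [hs, (Finset.mem_filter.1 hq).2])]
    rw [Finset.sum_congr rfl rhs, Finset.sum_sigma']
    refine Finset.sum_nbij' (fun x => ⟨x.2, x.1⟩) (fun x => ⟨x.2, x.1⟩) ?_ ?_ ?_ ?_ ?_
    · rintro ⟨p, q⟩ h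
      simp only [Finset.mem_sigma, Finset.mem_filter, Finset.mem_powerset,
        Finset.subset_sdiff] at h ⊢
      exact ⟨⟨h.2.1, fun hq => Finset.disjoint_left.1 h.2.2 hq h.1.2⟩, ⟨h.1.1, h.2.2.symm⟩, h.1.2⟩
    · rintro ⟨q, p⟩ h
      simp only [Finset.mem_sigma, Finset.mem_filter, Finset.mem_powerset,
        Finset.subset_sdiff] at h ⊢
      exact ⟨⟨h.2.1.1, h.2.2⟩, h.1.1, h.2.1.2.symm⟩
    · rintro ⟨p, q⟩ _; rfl
    · rintro ⟨p, q⟩ _; rfl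
    · rintro ⟨p, q⟩ _
      simp only [sdiff_sdiff_comm]
      ring

/-- If inserting the index `s` into a moment acts as a constant plus a derivation, then inserting
it into a cumulant acts as the derivation. -/
theorem cumulantOf_insert {M : Finset ι → ℝ} (hM : M ∅ = 1) {V : ι → Finset ι → ℝ}
    (hV : ∀ u p, u ∉ p → V u p = M p) {s : ι}
    (h : ∀ p, s ∉ p → M (insert s p) = M {s} * M p + ∑ u ∈ p, V u p)
    {S : Finset ι} (hs : s ∉ S) (hS : S.Nonempty) :
    cumulantOf M (insert s S) = ∑ u ∈ S, cumulantOf (V u) S := by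
  -- The constant `M {s}` can only contribute to the first-order cumulant of `s`; on larger sets the
  -- candidate is the pure derivation. It suffices that it satisfies the triangular recursion.
  have key := eq_of_sum_mul_eq (x := cumulantOf M)
    (y := fun S => (if S = {s} then M {s} else 0) + ∑ u ∈ S.erase s, cumulantOf (V u) (S.erase s))
    hM s (fun S hS => ?_) (insert s S) (Finset.mem_insert_self s S)
  · rw [key, if_neg, zero_add, Finset.erase_insert hs]
    intro he
    have : S = ∅ := by rw [← Finset.erase_insert hs, he]; simp
    exact hS.ne_empty this
  · rw [sum_cumulantOf_mul hM hS]
    simp only [add_mul, Finset.sum_add_distrib, ite_mul, zero_mul]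
    rw [Finset.sum_ite_eq' _ ({s} : Finset ι), if_pos (by simp [hS]),
      Finset.sdiff_singleton_eq_erase]
    conv_lhs => rw [← Finset.insert_erase hS]
    rw [h _ (Finset.notMem_erase s S), sum_variation hM hV]
    congr 1
    refine Finset.sum_nbij' (fun p => insert s p) (fun p => p.erase s) ?_ ?_ ?_ ?_ ?_
    · intro p hp
      rw [Finset.mem_powerset] at hp
      simp only [Finset.mem_filter, Finset.mem_powerset, Finset.mem_insert_self, and_true]
      exact Finset.insert_subset hS (hp.trans (Finset.erase_subset _ _))
    · intro p hp
      simp only [Finset.mem_filter, Finset.mem_powerset] at hp ⊢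
      exact Finset.erase_subset_erase s hp.1
    · intro p hp
      rw [Finset.mem_powerset] at hp
      exact Finset.erase_insert fun h' => by simpa using hp h'
    · intro p hp
      exact Finset.insert_erase (Finset.mem_filter.1 hp).2
    · intro p hp
      rw [Finset.mem_powerset] at hp
      have : s ∉ p := fun h' => by simpa using hp h'
      rw [Finset.erase_insert this]
      congr 2
      ext x
      simp only [Finset.mem_sdiff, Finset.mem_erase, Finset.mem_insert]
      tauto

end CumulantCalculus

/-! ### Determinants over the ring of set functions. -/

section Determinant

open Matrix

variable {ι : Type*} [DecidableEq ι] {n : Type*}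

/-- The part of a matrix of set functions supported on the sets that contain `s`. -/
def containing (s : ι) (A : Matrix n n (SetFun ι)) : Matrix n n (SetFun ι) :=
  fun a b S => if s ∈ S then A a b S else 0

theorem containing_apply (s : ι) (A : Matrix n n (SetFun ι)) (a b : n) (S : Finset ι) :
    containing s A a b S = if s ∈ S then A a b S else 0 := rfl

/-- The shift `S ↦ u (S ∪ {s})` of a set function. -/
def insertFun (s : ι) (u : SetFun ι) : SetFun ι := fun S => u (insert s S)

theorem insertFun_apply (s : ι) (u : SetFun ι) (S : Finset ι) :
    insertFun s u S = u (insert s S) := rfl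

/-- The set functions supported on sets containing `s` form the ideal $(t_s)$, whose square is zero.
-/
theorem exists_containing_eq_smul (s : ι) (A : Matrix n n (SetFun ι)) :
    ∃ B : Matrix n n (SetFun ι), containing s A = SetFun.single {s} • B := by
  refine ⟨A.map (insertFun s), ?_⟩
  ext a b S
  rw [containing_apply, Matrix.smul_apply, smul_eq_mul, SetFun.single_mul_apply, Matrix.map_apply]
  by_cases h : s ∈ S
  · simp [h, insertFun_apply]
  · simp [h]

variable [Fintype n] [DecidableEq n]

theorem single_mul_self (s : ι) : SetFun.single {s} * SetFun.single {s} = (0 : SetFun ι) := by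
  rw [SetFun.single_mul_single]
  simp

/-- The cumulant recursion for the determinant of an invertible matrix of set functions. -/
theorem det_apply_eq_sum {A W : Matrix n n (SetFun ι)} (hW : A * W = 1) {s : ι} {S : Finset ι}
    (hs : s ∈ S) :
    A.det S = ∑ p ∈ S.powerset with s ∈ p, (W * containing s A).trace p * A.det (S \ p) := by
  obtain ⟨B, hB⟩ := exists_containing_eq_smul s A
  -- Factoring out `A` leaves $1-t_sWB$. As $t_s^2=0$, the expansion of its determinant stops at the
  -- trace.
  have h1 : A - containing s A = A * (1 + SetFun.single {s} • (-(W * B))) := by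
    rw [hB, mul_add, mul_one, smul_neg, mul_neg, mul_smul_comm, ← mul_assoc, hW, one_mul,
      sub_eq_add_neg]
  have h2 : (A - containing s A).det = A.det * (1 - (W * containing s A).trace) := by
    rw [h1, det_mul, det_one_add_smul, pow_two, single_mul_self, mul_zero, add_zero, hB,
      trace_neg, mul_smul_comm, trace_smul, smul_eq_mul, neg_mul, ← sub_eq_add_neg, mul_comm _ (trace _)]
  have h3 : A - containing s A = (SetFun.avoid s).mapMatrix A := by
    ext a b T
    rw [RingHom.mapMatrix_apply, Matrix.map_apply, SetFun.avoid_apply, Matrix.sub_apply,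
      SetFun.sub_apply, containing_apply]
    split_ifs <;> simp
  -- Discarding the sets that contain `s` is a ring homomorphism, so it commutes with the
  -- determinant, and the result has no coefficient at `S`.
  have h4 : (A - containing s A).det S = 0 := by
    rw [h3, ← RingHom.map_det, SetFun.avoid_apply, if_pos hs]
  have h5 : (W * containing s A).trace = SetFun.single {s} * (W * B).trace := by
    rw [hB, mul_smul_comm, trace_smul, smul_eq_mul]
  rw [h2, mul_sub, mul_one, SetFun.sub_apply, sub_eq_zero, mul_comm, SetFun.mul_apply] at h4
  rw [h4, Finset.sum_filter]
  refine Finset.sum_congr rfl fun p _ => ?_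
  split_ifs with h
  · rfl
  · rw [h5, SetFun.single_mul_apply, if_neg (by simpa using h), zero_mul]

/-- The powers of a matrix of set functions that vanish at `∅`. -/
theorem pow_apply_eq_zero {M : Matrix n n (SetFun ι)} (hM : ∀ a b, M a b ∅ = 0) (k : ℕ)
    (a b : n) (S : Finset ι) (hS : S.card < k) : (M ^ k) a b S = 0 := by
  induction k generalizing a b S with
  | zero => omega
  | succ k ih =>
    rw [pow_succ, Matrix.mul_apply, SetFun.sum_apply]
    refine Finset.sum_eq_zero fun c _ => ?_
    rw [SetFun.mul_apply]
    refine Finset.sum_eq_zero fun p hp => ?_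
    rw [Finset.mem_powerset] at hp
    rcases eq_or_ne p S with rfl | hne
    · rw [sdiff_self, Finset.bot_eq_empty, hM, mul_zero]
    · have := Finset.card_lt_card (Finset.ssubset_iff_subset_ne.2 ⟨hp, hne⟩)
      rw [ih _ _ _ (by omega), zero_mul]

/-- Neumann series for a unipotent matrix of set functions. -/
theorem one_add_mul_sum_pow [Fintype ι] {M : Matrix n n (SetFun ι)} (hM : ∀ a b, M a b ∅ = 0) :
    (1 + M) * ∑ k ∈ Finset.range (Fintype.card ι + 1), (-M) ^ k = 1 := by
  have h : (-M) ^ (Fintype.card ι + 1) = 0 := by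
    ext a b S
    rw [pow_apply_eq_zero (fun a b => by simp [hM])]
    · rfl
    · have := Finset.card_le_univ S
      omega
  have := mul_neg_geom_sum (-M) (Fintype.card ι + 1)
  rwa [h, sub_zero, sub_neg_eq_add] at this

end Determinant

/-! ### Closed paths, cyclic permutations and ordered partitions. -/

section CyclicSums

theorem list_prod_ofFn_apply {n R : Type*} [Fintype n] [DecidableEq n] [CommRing R] (k : ℕ)
    (N : Fin (k + 1) → Matrix n n R) (x y : n) :
    (List.ofFn N).prod x y = ∑ b : Fin k → n,
      (∏ j : Fin k, N j.castSucc ((Fin.cons x b : Fin (k + 1) → n) j.castSucc) (b j)) *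
        N (Fin.last k) ((Fin.cons x b : Fin (k + 1) → n) (Fin.last k)) y := by
  induction k generalizing x with
  | zero => simp
  | succ k ih =>
    rw [List.ofFn_succ, List.prod_cons, Matrix.mul_apply,
      ← (Fin.consEquiv fun _ : Fin (k + 1) => n).sum_comp, Fintype.sum_prod_type]
    refine Finset.sum_congr rfl fun z _ => ?_
    rw [ih, Finset.mul_sum]
    refine Finset.sum_congr rfl fun b _ => ?_
    rw [Fin.prod_univ_succ]
    simp only [Fin.consEquiv_apply, Fin.castSucc_zero, Fin.cons_zero, Fin.castSucc_succ,
      Fin.cons_succ, ← Fin.succ_last]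
    ring

/-- The trace of a product of matrices as a sum over closed paths. -/
theorem trace_list_prod_ofFn {n R : Type*} [Fintype n] [DecidableEq n] [CommRing R] (k : ℕ)
    (N : Fin (k + 1) → Matrix n n R) :
    (List.ofFn N).prod.trace = ∑ a : Fin (k + 1) → n, ∏ i, N i (a i) (a (i + 1)) := by
  rw [← (Fin.consEquiv fun _ : Fin (k + 1) => n).sum_comp, Fintype.sum_prod_type, Matrix.trace]
  refine Finset.sum_congr rfl fun x _ => ?_
  rw [Matrix.diag_apply, list_prod_ofFn_apply]
  refine Finset.sum_congr rfl fun b _ => ?_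
  rw [Fin.prod_univ_castSucc]
  simp only [Fin.consEquiv_apply, Fin.last_add_one, Fin.cons_zero, Fin.coeSucc_eq_succ, Fin.cons_succ]

theorem trace_mul_pow {n R : Type*} [Fintype n] [DecidableEq n] [CommRing R] (k : ℕ)
    (N M : Matrix n n R) :
    (N * M ^ k).trace =
      ∑ a : Fin (k + 1) → n, ∏ i, (if i = 0 then N else M) (a i) (a (i + 1)) := by
  rw [← trace_list_prod_ofFn, List.ofFn_succ]
  simp [Fin.succ_ne_zero, List.ofFn_const]

/-- The orbit of a point under a cyclic permutation enumerates the type. -/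
theorem exists_orbit_equiv {α : Type*} [Fintype α] {σ : Equiv.Perm α}
    (hσ : σ.IsCycleOn Set.univ) {k : ℕ} (hk : Fintype.card α = k + 1) (x : α) :
    ∃ e : Fin (k + 1) ≃ α, (∀ i, e i = (σ ^ (i : ℕ)) x) ∧ ∀ i, e (i + 1) = σ (e i) := by
  have hσ' : σ.IsCycleOn ((Finset.univ : Finset α) : Set α) := by simpa using hσ
  have hinj : Function.Injective fun i : Fin (k + 1) => (σ ^ (i : ℕ)) x := by
    intro i j h
    have := (hσ'.pow_apply_eq_pow_apply (Finset.mem_univ x)).1 h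
    rw [Finset.card_univ, hk] at this
    exact Fin.ext (Nat.ModEq.eq_of_lt_of_lt this i.2 j.2)
  refine ⟨Equiv.ofBijective _ ((Fintype.bijective_iff_injective_and_card _).2
    ⟨hinj, by simp [hk]⟩), fun i => rfl, fun i => ?_⟩
  rw [Equiv.ofBijective_apply, Equiv.ofBijective_apply, ← Equiv.Perm.mul_apply, ← pow_succ']
  apply (hσ'.pow_apply_eq_pow_apply (Finset.mem_univ x)).2
  rw [Finset.card_univ, hk, Fin.val_add, Nat.ModEq, Nat.mod_mod, Fin.val_one', Nat.add_mod_mod]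

/-- The rotation of an enumeration is a cyclic permutation. -/
theorem exists_rotation {α : Type*} {k : ℕ} (e : Fin (k + 1) ≃ α) :
    ∃ σ : Equiv.Perm α, σ.IsCycleOn Set.univ ∧ ∀ i : Fin (k + 1), (σ ^ (i : ℕ)) (e 0) = e i := by
  set σ : Equiv.Perm α := e.symm.trans ((finRotate _).trans e) with hσ
  have hstep : ∀ i, σ (e i) = e (i + 1) := fun i => by simp [hσ]
  have hpow : ∀ j : ℕ, ∀ hj : j < k + 1, (σ ^ j) (e 0) = e ⟨j, hj⟩ := by
    intro j
    induction j with
    | zero => intro _; rfl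
    | succ j ih =>
      intro hj
      rw [pow_succ', Equiv.Perm.mul_apply, ih (by omega), hstep]
      congr 1
      ext
      rw [Fin.val_add_one_of_lt' hj]
  refine ⟨σ, ⟨σ.bijective.bijOn_univ, fun x _ y _ => ?_⟩, fun i => hpow i i.2⟩
  have h0 : ∀ y, σ.SameCycle (e 0) y := fun y => by
    refine ⟨((e.symm y : ℕ) : ℤ), ?_⟩
    rw [zpow_natCast, hpow _ (e.symm y).2]
    simp
  exact (h0 x).symm.trans (h0 y)

variable {ι : Type*} [Fintype ι] [DecidableEq ι]

/-- `B` is an ordered partition of `ι` into nonempty sets, the first of which contains `s`. -/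
structure IsOrderedPartition {k : ℕ} (s : ι) (B : Fin (k + 1) → Finset ι) : Prop where
  mem_zero : s ∈ B 0
  ne_empty : ∀ i, B i ≠ ∅
  pairwiseDisjoint : ((Finset.univ : Finset (Fin (k + 1))) : Set (Fin (k + 1))).PairwiseDisjoint B
  biUnion_eq : Finset.univ.biUnion B = Finset.univ

theorem Finpartition.card_parts_coe (P : Finpartition (Finset.univ : Finset ι)) :
    Fintype.card P.parts = P.parts.card := Fintype.card_coe _

theorem Finpartition.parts_eq_image (P : Finpartition (Finset.univ : Finset ι)) {k : ℕ}
    (e : Fin (k + 1) ≃ P.parts) : P.parts = Finset.univ.image fun i => (e i).1 := by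
  ext p
  simp only [Finset.mem_image, Finset.mem_univ, true_and]
  constructor
  · intro hp; exact ⟨e.symm ⟨p, hp⟩, by simp⟩
  · rintro ⟨i, rfl⟩; exact (e i).2

/-- The block of `s`. -/
def Finpartition.baseBlock (P : Finpartition (Finset.univ : Finset ι)) (s : ι) : P.parts :=
  ⟨P.part s, P.part_mem.2 (Finset.mem_univ s)⟩

theorem Finpartition.isOrderedPartition (P : Finpartition (Finset.univ : Finset ι)) {k : ℕ}
    (e : Fin (k + 1) ≃ P.parts) {s : ι} (he : e 0 = P.baseBlock s) :
    IsOrderedPartition s fun i => (e i).1 where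
  mem_zero := by
    rw [he]; exact P.mem_part_self.2 (Finset.mem_univ s)
  ne_empty i := P.ne_empty (e i).2
  pairwiseDisjoint := by
    intro i _ j _ hij
    exact P.disjoint (e i).2 (e j).2 fun h => hij (e.injective (Subtype.ext h))
  biUnion_eq := by
    conv_rhs => rw [← P.biUnion_parts, P.parts_eq_image e]
    rw [Finset.image_biUnion]
    rfl

theorem IsOrderedPartition.exists_finpartition {k : ℕ} {s : ι} {B : Fin (k + 1) → Finset ι}
    (hB : IsOrderedPartition s B) :
    ∃ (P : Finpartition (Finset.univ : Finset ι)) (e : Fin (k + 1) ≃ P.parts),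
      e 0 = P.baseBlock s ∧ ∀ i, (e i).1 = B i := by
  have hinj : Function.Injective B := by
    intro i j h
    by_contra hij
    have := hB.pairwiseDisjoint (Finset.mem_univ i) (Finset.mem_univ j) hij
    rw [Function.onFun, h, Finset.disjoint_self_iff_empty] at this
    exact hB.ne_empty j this
  have hQ : Finset.univ.image B ∈ partitionSets (Finset.univ : Finset ι) := by
    rw [mem_partitionSets]
    refine ⟨?_, ?_, ?_⟩
    · rw [Finset.coe_image]
      rintro _ ⟨i, -, rfl⟩ _ ⟨j, -, rfl⟩ hij
      exact hB.pairwiseDisjoint (Finset.mem_univ i) (Finset.mem_univ j) fun h => hij (h ▸ rfl)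
    · rw [Finset.image_biUnion]
      exact hB.biUnion_eq
    · simp [hB.ne_empty]
  obtain ⟨P, -, hP⟩ := Finset.mem_image.1 hQ
  have hmem : ∀ i, B i ∈ P.parts := fun i => by rw [hP]; simp
  refine ⟨P, Equiv.ofBijective (fun i => (⟨B i, hmem i⟩ : P.parts)) ⟨?_, ?_⟩, ?_, fun i => rfl⟩
  · intro i j h
    exact hinj (Subtype.ext_iff.1 h)
  · rintro ⟨p, hp⟩
    rw [hP, Finset.mem_image] at hp
    obtain ⟨i, -, rfl⟩ := hp
    exact ⟨i, rfl⟩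
  · apply Subtype.ext
    exact (P.part_eq_of_mem (hmem 0) hB.mem_zero).symm

open scoped Classical in
/-- Pairs of a partition and a cyclic permutation of its blocks correspond to ordered partitions
whose first block contains `s`. -/
theorem sum_cyclic_card_eq {n : Type*} [Fintype n] (A : Finset ι → Matrix n n ℝ) (s : ι)
    (k : ℕ) :
    ∑ P : Finpartition (Finset.univ : Finset ι) with P.parts.card = k + 1,
      ∑ σ ∈ Finset.univ.filter fun σ : Equiv.Perm P.parts => σ.IsCycleOn Set.univ,
        ∑ a : P.parts → n, ∏ p : P.parts, A p.1 (a p) (a (σ p)) =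
    ∑ B : Fin (k + 1) → Finset ι with IsOrderedPartition s B,
      ∑ a : Fin (k + 1) → n, ∏ i, A (B i) (a i) (a (i + 1)) := by
  rw [Finset.sum_sigma']
  -- A pair $(P,\sigma)$ is sent to the orbit of the block of `s` under $\sigma$. Fixing the
  -- starting block removes the rotational ambiguity, so this is a bijection.
  refine Finset.sum_bij (fun x _ => fun i : Fin (k + 1) =>
    ((x.2 ^ (i : ℕ)) (x.1.baseBlock s)).1) ?_ ?_ ?_ ?_
  · rintro ⟨P, σ⟩ h
    simp only [Finset.mem_sigma, Finset.mem_filter, Finset.mem_univ, true_and] at h ⊢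
    obtain ⟨e, he, -⟩ := exists_orbit_equiv h.2 (P.card_parts_coe.trans h.1) (P.baseBlock s)
    have := P.isOrderedPartition e (s := s) (by rw [he]; rfl)
    simpa only [he] using this
  · rintro ⟨P, σ⟩ h ⟨P', σ'⟩ h' heq
    simp only [Finset.mem_sigma, Finset.mem_filter, Finset.mem_univ, true_and] at h h'
    obtain ⟨e, he, he1⟩ := exists_orbit_equiv h.2 (P.card_parts_coe.trans h.1) (P.baseBlock s)
    obtain ⟨e', he', he1'⟩ :=
      exists_orbit_equiv h'.2 (P'.card_parts_coe.trans h'.1) (P'.baseBlock s)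
    have hval : ∀ i, (e i).1 = (e' i).1 := fun i => by
      rw [he, he']; exact congrFun heq i
    have hP : P = P' := by
      apply Finpartition.ext
      rw [P.parts_eq_image e, P'.parts_eq_image e']
      simp only [hval]
    subst hP
    have hee : e = e' := Equiv.ext fun i => Subtype.ext (hval i)
    subst hee
    congr 1
    refine Equiv.ext fun p => ?_
    obtain ⟨i, rfl⟩ := e.surjective p
    rw [← he1, he1']
  · intro B hB
    simp only [Finset.mem_filter, Finset.mem_univ, true_and] at hB
    obtain ⟨P, e, he0, heB⟩ := hB.exists_finpartition
    obtain ⟨σ, hσ, hσe⟩ := exists_rotation e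
    refine ⟨⟨P, σ⟩, ?_, ?_⟩
    · simp only [Finset.mem_sigma, Finset.mem_filter, Finset.mem_univ, true_and]
      refine ⟨?_, hσ⟩
      rw [← P.card_parts_coe, ← Fintype.card_congr e, Fintype.card_fin]
    · funext i
      simp only
      rw [← he0, hσe, heB]
  · rintro ⟨P, σ⟩ h
    simp only [Finset.mem_sigma, Finset.mem_filter, Finset.mem_univ, true_and] at h
    obtain ⟨e, he, he1⟩ := exists_orbit_equiv h.2 (P.card_parts_coe.trans h.1) (P.baseBlock s)
    simp only [← he]
    rw [← (e.arrowCongr (Equiv.refl n)).sum_comp]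
    refine Finset.sum_congr rfl fun a _ => ?_
    rw [← e.prod_comp]
    refine Finset.prod_congr rfl fun i _ => ?_
    simp [← he1]

open scoped Classical in
theorem sum_cyclic_eq {n : Type*} [Fintype n] (A : Finset ι → Matrix n n ℝ) (s : ι)
    (h : ℕ → ℝ) :
    ∑ P : Finpartition (Finset.univ : Finset ι), h (P.parts.card - 1) *
      ∑ σ ∈ Finset.univ.filter fun σ : Equiv.Perm P.parts => σ.IsCycleOn Set.univ,
        ∑ a : P.parts → n, ∏ p : P.parts, A p.1 (a p) (a (σ p)) =
    ∑ k ∈ Finset.range (Fintype.card ι + 1), h k *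
      ∑ B : Fin (k + 1) → Finset ι with IsOrderedPartition s B,
        ∑ a : Fin (k + 1) → n, ∏ i, A (B i) (a i) (a (i + 1)) := by
  have hmaps : ∀ P ∈ (Finset.univ : Finset (Finpartition (Finset.univ : Finset ι))),
      P.parts.card - 1 ∈ Finset.range (Fintype.card ι + 1) := fun P _ => by
    have := P.card_parts_le_card
    rw [Finset.card_univ] at this
    rw [Finset.mem_range]
    omega
  rw [← Finset.sum_fiberwise_of_maps_to hmaps]
  refine Finset.sum_congr rfl fun k _ => ?_
  rw [← sum_cyclic_card_eq A s k, Finset.mul_sum]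
  refine Finset.sum_congr ?_ fun P hP => ?_
  · ext P
    -- There is a block, that of `s`, so the truncated $|P|-1$ equals $k$ exactly when $|P|=k+1$.
    have : 0 < P.parts.card := by
      rw [Finset.card_pos]
      exact ⟨_, (P.baseBlock s).2⟩
    simp only [Finset.mem_filter, Finset.mem_univ, true_and]
    omega
  · rw [(Finset.mem_filter.1 hP).2, Nat.add_sub_cancel]

end CyclicSums

/-! ### Cumulants when the moments are coefficients of a determinant. -/

section DeterminantalCumulants

variable {ι : Type*} [DecidableEq ι] {n : Type*} [Fintype n] [DecidableEq n]

theorem det_apply_empty {A : Matrix n n (SetFun ι)}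
    (hA : ∀ a b, A a b ∅ = (1 : Matrix n n ℝ) a b) : A.det ∅ = 1 := by
  have h : SetFun.evalEmpty A.det = 1 := by
    rw [RingHom.map_det]
    have : SetFun.evalEmpty.mapMatrix A = 1 := by
      ext a b
      exact hA a b
    rw [this, Matrix.det_one]
  exact h

variable [Fintype ι]

-- The monomial factor forces disjoint sets with full union, and the other factors force $s\in B_0$
-- and the remaining sets to be nonempty. In the next proof the last two conditions come from
-- `containing s A` and from the matrix $A-1$.
open scoped Classical in
theorem prod_single_univ_of_mem {k : ℕ} {s : ι} (B : Fin (k + 1) → Finset ι) :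
    ((∏ i, SetFun.single (B i)) Finset.univ *
      ((if s ∈ B 0 then 1 else 0) * ∏ i ∈ Finset.univ.erase 0, if B i = ∅ then 0 else 1) : ℝ) =
      if IsOrderedPartition s B then 1 else 0 := by
  rw [SetFun.prod_single]
  by_cases hB : IsOrderedPartition s B
  · rw [if_pos hB, if_pos hB.pairwiseDisjoint, hB.biUnion_eq, SetFun.single_apply, if_pos rfl,
      if_pos hB.mem_zero, Finset.prod_eq_one]
    · norm_num
    · intro i _
      rw [if_neg (hB.ne_empty i)]
  · rw [if_neg hB]
    by_contra hne
    obtain ⟨h1, h23⟩ := ne_zero_and_ne_zero_of_mul hne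
    obtain ⟨h2, h3⟩ := ne_zero_and_ne_zero_of_mul h23
    have h2' : s ∈ B 0 := by
      by_contra h; exact h2 (if_neg h)
    split_ifs at h1 with hd
    · refine hB ⟨h2', fun i => ?_, hd, ?_⟩
      · by_cases hi : i = 0
        · rw [hi]; exact Finset.ne_empty_of_mem h2'
        · intro h
          exact Finset.prod_ne_zero_iff.1 h3 i (by simp [hi]) (if_pos h)
      · by_contra h
        exact h1 (by rw [SetFun.single_apply, if_neg (fun h' => h h'.symm)])
    · exact h1 rfl

open scoped Classical in
/-- The cumulants of a determinantal set function: a sum over partitions and cyclic permutations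
of their blocks. -/
theorem cumulantOf_det_univ [Nonempty ι] (A : Matrix n n (SetFun ι))
    (hA : ∀ a b, A a b ∅ = (1 : Matrix n n ℝ) a b) :
    cumulantOf A.det Finset.univ =
      ∑ P : Finpartition (Finset.univ : Finset ι), (-1) ^ (P.parts.card - 1) *
        ∑ σ ∈ Finset.univ.filter fun σ : Equiv.Perm P.parts => σ.IsCycleOn Set.univ,
          ∑ a : P.parts → n, ∏ p : P.parts, A (a p) (a (σ p)) p.1 := by
  obtain ⟨s⟩ := ‹Nonempty ι›
  set M : Matrix n n (SetFun ι) := A - 1 with hM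
  have hM0 : ∀ a b, M a b ∅ = 0 := fun a b => by
    rw [hM, Matrix.sub_apply, SetFun.sub_apply, hA]
    by_cases h : a = b
    · subst h; simp [SetFun.one_apply]
    · simp [h]
  have hMB : ∀ a b B, M a b B = (if B = ∅ then 0 else 1) * A a b B := fun a b B => by
    by_cases hB : B = ∅
    · rw [hB, hM0]; simp
    · rw [hM, Matrix.sub_apply, SetFun.sub_apply, if_neg hB, one_mul, sub_eq_self]
      by_cases h : a = b
      · subst h; simp [SetFun.one_apply, hB]
      · simp [h]
  -- $A=1+M$ with $M$ vanishing at `∅`, so $M$ is nilpotent and the Neumann series for $A^{-1}$ is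
  -- finite. The trace attached to `W` then obeys the moment-cumulant recursion.
  set W := ∑ k ∈ Finset.range (Fintype.card ι + 1), (-M) ^ k with hWdef
  have hW : A * W = 1 := by
    have := one_add_mul_sum_pow hM0
    rwa [hM, add_sub_cancel] at this
  have h1 : cumulantOf A.det Finset.univ = (W * containing s A).trace Finset.univ := by
    refine eq_of_sum_mul_eq (M := A.det) (x := cumulantOf A.det)
      (y := (W * containing s A).trace) (det_apply_empty hA) s (fun S hS => ?_)
      Finset.univ (Finset.mem_univ s)
    rw [sum_cumulantOf_mul (det_apply_empty hA) hS]
    exact det_apply_eq_sum hW hS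
  refine h1.trans (Eq.trans ?_
    (sum_cyclic_eq (fun B => Matrix.of fun a b => A a b B) s fun k => (-1) ^ k).symm)
  rw [hWdef, Finset.sum_mul, Matrix.trace_sum, SetFun.sum_apply]
  refine Finset.sum_congr rfl fun k _ => ?_
  -- Cyclicity of the trace moves the factor containing `s` to position $0$, and $(-1)^k$ becomes
  -- the sign $(-1)^{|P|-1}$.
  have h2 : ((-M) ^ k * containing s A).trace =
      ((-1 : ℝ) ^ k) • (containing s A * M ^ k).trace := by
    rw [Matrix.trace_mul_comm]
    rcases Nat.even_or_odd k with h | h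
    · rw [h.neg_pow, h.neg_one_pow, one_smul]
    · rw [h.neg_pow, h.neg_one_pow, mul_neg, Matrix.trace_neg, neg_one_smul]
  rw [h2, SetFun.smul_apply, trace_mul_pow, SetFun.sum_apply]
  congr 1
  rw [Finset.sum_congr rfl fun a _ => SetFun.prod_apply _ _, Finset.sum_comm, Finset.sum_filter]
  refine Finset.sum_congr rfl fun B _ => ?_
  rw [← Finset.mul_sum]
  have h3 : ∀ a : Fin (k + 1) → n,
      ∏ i, (if i = 0 then containing s A else M) (a i) (a (i + 1)) (B i) =
        ((if s ∈ B 0 then 1 else 0) * ∏ i ∈ Finset.univ.erase 0, if B i = ∅ then 0 else 1) *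
          ∏ i, A (a i) (a (i + 1)) (B i) := fun a => by
    rw [← Finset.mul_prod_erase _ _ (Finset.mem_univ (0 : Fin (k + 1))),
      ← Finset.mul_prod_erase _ (fun i => A (a i) (a (i + 1)) (B i))
        (Finset.mem_univ (0 : Fin (k + 1))), if_pos rfl, containing_apply]
    have : ∀ i ∈ Finset.univ.erase (0 : Fin (k + 1)),
        (if i = 0 then containing s A else M) (a i) (a (i + 1)) (B i) =
          (if B i = ∅ then 0 else 1) * A (a i) (a (i + 1)) (B i) := fun i hi => by
      rw [if_neg (Finset.ne_of_mem_erase hi), hMB]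
    rw [Finset.prod_congr rfl this, Finset.prod_mul_distrib]
    split_ifs <;> ring
  simp only [h3]
  rw [← Finset.mul_sum, ← mul_assoc, prod_single_univ_of_mem]
  simp

end DeterminantalCumulants

/-! ### A class of functions stable under products, and integration by parts on the half line. -/

section Moderate

open Set Filter Topology

theorem one_le_rpow_mul_one_add_pow {ε x : ℝ} (hε : 0 ≤ ε) {N : ℕ} (hN : ε ≤ N) (hx : 0 < x) :
    1 ≤ x ^ (-ε) * (1 + x) ^ N := by
  rw [Real.rpow_neg hx.le, ← div_eq_inv_mul, one_le_div (Real.rpow_pos_of_pos hx _)]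
  calc x ^ ε ≤ (1 + x) ^ ε := Real.rpow_le_rpow hx.le (by linarith) hε
    _ ≤ (1 + x) ^ (N : ℝ) := Real.rpow_le_rpow_of_exponent_le (by linarith) hN
    _ = _ := Real.rpow_natCast _ _

theorem rpow_le_rpow_mul_one_add_pow {k ε x : ℝ} (h : 0 ≤ k + ε) {N : ℕ} (hN : k + ε ≤ N)
    (hx : 0 < x) : x ^ k ≤ x ^ (-ε) * (1 + x) ^ N := by
  have h1 := one_le_rpow_mul_one_add_pow h hN hx
  have h2 : x ^ (-ε) = x ^ k * x ^ (-(k + ε)) := by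
    rw [← Real.rpow_add hx]; congr 1; ring
  rw [h2, mul_assoc]
  exact le_mul_of_one_le_right (Real.rpow_nonneg hx.le _) h1

/-- A continuous function on `(0,∞)` with polynomial growth at infinity and growth slower than any
negative power at `0`. -/
def Moderate (g : ℝ → ℝ) : Prop :=
  ContinuousOn g (Ioi 0) ∧ ∀ ε : ℝ, 0 < ε → ∃ (C : ℝ) (N : ℕ), 0 ≤ C ∧ ∀ x, 0 < x →
    |g x| ≤ C * (x ^ (-ε) * (1 + x) ^ N)

theorem Moderate.const (c : ℝ) : Moderate fun _ => c := by
  refine ⟨continuousOn_const, fun ε hε => ?_⟩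
  obtain ⟨N, hN⟩ := exists_nat_ge ε
  exact ⟨|c|, N, abs_nonneg c, fun x hx =>
    le_mul_of_one_le_right (abs_nonneg c) (one_le_rpow_mul_one_add_pow hε.le hN hx)⟩

theorem Moderate.rpow {k : ℝ} (hk : 0 ≤ k) : Moderate fun x => x ^ k := by
  refine ⟨fun x hx => (Real.continuousAt_rpow_const x k (Or.inl (ne_of_gt hx))).continuousWithinAt,
    fun ε hε => ?_⟩
  obtain ⟨N, hN⟩ := exists_nat_ge (k + ε)
  refine ⟨1, N, zero_le_one, fun x hx => ?_⟩
  rw [abs_of_nonneg (Real.rpow_nonneg hx.le k), one_mul]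
  exact rpow_le_rpow_mul_one_add_pow (by positivity) hN hx

theorem Moderate.log : Moderate Real.log := by
  refine ⟨fun x hx => (Real.continuousAt_log (ne_of_gt hx)).continuousWithinAt, fun ε hε => ?_⟩
  obtain ⟨N, hN⟩ := exists_nat_ge (ε + ε)
  refine ⟨1 / ε, N, by positivity, fun x hx => ?_⟩
  rw [div_mul_eq_mul_div, one_mul, abs_le']
  constructor
  · refine (Real.log_le_rpow_div hx.le hε).trans ?_
    gcongr
    exact rpow_le_rpow_mul_one_add_pow (by positivity) hN hx
  · rw [← Real.log_inv]
    refine (Real.log_le_rpow_div (inv_pos.2 hx).le hε).trans ?_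
    gcongr
    rw [Real.inv_rpow hx.le, ← Real.rpow_neg hx.le]
    exact le_mul_of_one_le_right (Real.rpow_nonneg hx.le _)
      (one_le_pow₀ (by linarith))

theorem Moderate.add {f g : ℝ → ℝ} (hf : Moderate f) (hg : Moderate g) :
    Moderate fun x => f x + g x := by
  refine ⟨hf.1.add hg.1, fun ε hε => ?_⟩
  obtain ⟨C, N, hC, h⟩ := hf.2 ε hε
  obtain ⟨C', N', hC', h'⟩ := hg.2 ε hε
  refine ⟨C + C', max N N', by positivity, fun x hx => (abs_add_le _ _).trans ?_⟩
  have hp := Real.rpow_nonneg hx.le (-ε)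
  rw [add_mul]
  refine add_le_add ((h x hx).trans ?_) ((h' x hx).trans ?_)
  · gcongr
    · linarith
    · exact le_max_left _ _
  · gcongr
    · linarith
    · exact le_max_right _ _

theorem Moderate.mul {f g : ℝ → ℝ} (hf : Moderate f) (hg : Moderate g) :
    Moderate fun x => f x * g x := by
  refine ⟨hf.1.mul hg.1, fun ε hε => ?_⟩
  obtain ⟨C, N, hC, h⟩ := hf.2 (ε / 2) (by positivity)
  obtain ⟨C', N', hC', h'⟩ := hg.2 (ε / 2) (by positivity)
  refine ⟨C * C', N + N', by positivity, fun x hx => ?_⟩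
  have hp := Real.rpow_nonneg hx.le (-(ε / 2))
  have e : x ^ (-ε) = x ^ (-(ε / 2)) * x ^ (-(ε / 2)) := by
    rw [← Real.rpow_add hx]; congr 1; ring
  rw [abs_mul]
  calc |f x| * |g x| ≤ (C * (x ^ (-(ε / 2)) * (1 + x) ^ N)) *
        (C' * (x ^ (-(ε / 2)) * (1 + x) ^ N')) :=
        mul_le_mul (h x hx) (h' x hx) (abs_nonneg _) (by positivity)
    _ = _ := by rw [e, pow_add]; ring

theorem Moderate.integrableOn {g : ℝ → ℝ} (hg : Moderate g) :
    IntegrableOn (fun x => g x * Real.exp (-x)) (Ioi 0) := by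
  -- Any exponent below $1$ would be integrable at $0$. With $1/2$ the bound splits into two Gamma
  -- integrands through $(1+x)^N\le 2^{N-1}(1+x^N)$, which also holds for $N=0$ with truncated
  -- subtraction.
  obtain ⟨C, N, hC, h⟩ := hg.2 (1 / 2) (by norm_num)
  have h1 := Real.GammaIntegral_convergent (s := 1 / 2) (by norm_num)
  have h2 := Real.GammaIntegral_convergent (s := N + 1 / 2) (by positivity)
  refine Integrable.mono' ((h1.add h2).const_mul (C * 2 ^ (N - 1)))
    ((hg.1.mul (by fun_prop)).aestronglyMeasurable measurableSet_Ioi) ?_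
  refine (ae_restrict_iff' measurableSet_Ioi).2 (Eventually.of_forall fun x (hx : 0 < x) => ?_)
  rw [norm_mul, Real.norm_eq_abs, Real.norm_eq_abs, Real.abs_exp, Pi.add_apply]
  have hp := Real.rpow_nonneg hx.le (-(1 / 2))
  have e1 : x ^ ((1 : ℝ) / 2 - 1) = x ^ (-((1 : ℝ) / 2)) := by norm_num
  have e2 : x ^ ((N : ℝ) + 1 / 2 - 1) = x ^ (-((1 : ℝ) / 2)) * x ^ N := by
    rw [← Real.rpow_natCast, ← Real.rpow_add hx]; congr 1; ring
  have e3 := add_pow_le zero_le_one hx.le N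
  calc |g x| * Real.exp (-x) ≤ C * (x ^ (-(1 / 2) : ℝ) * (1 + x) ^ N) * Real.exp (-x) := by
        gcongr; exact h x hx
    _ ≤ C * (x ^ (-(1 / 2) : ℝ) * (2 ^ (N - 1) * (1 ^ N + x ^ N))) * Real.exp (-x) := by gcongr
    _ = _ := by rw [e1, e2]; ring

/-- `g'` is the Euler derivative `x dg/dx` of `g`, and both are moderate. -/
structure EulerPair (g g' : ℝ → ℝ) : Prop where
  moderate : Moderate g
  moderate' : Moderate g'
  hasDerivAt : ∀ x, 0 < x → HasDerivAt g (g' x / x) x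

theorem EulerPair.const (c : ℝ) : EulerPair (fun _ => c) fun _ => 0 :=
  ⟨.const c, .const 0, fun x _ => by simpa using hasDerivAt_const x c⟩

theorem EulerPair.rpow {k : ℝ} (hk : 0 ≤ k) : EulerPair (fun x => x ^ k) fun x => k * x ^ k :=
  ⟨.rpow hk, (Moderate.const k).mul (.rpow hk), fun x hx => by
    have := Real.hasDerivAt_rpow_const (x := x) (p := k) (Or.inl hx.ne')
    rwa [Real.rpow_sub_one hx.ne', ← mul_div_assoc] at this⟩

theorem EulerPair.pow (j : ℕ) : EulerPair (fun x => x ^ j) fun x => j * x ^ j := by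
  simpa only [Real.rpow_natCast] using EulerPair.rpow (Nat.cast_nonneg j)

theorem EulerPair.log : EulerPair Real.log fun _ => 1 :=
  ⟨.log, .const 1, fun x hx => by simpa using Real.hasDerivAt_log hx.ne'⟩

theorem EulerPair.add {f f' g g' : ℝ → ℝ} (hf : EulerPair f f') (hg : EulerPair g g') :
    EulerPair (fun x => f x + g x) fun x => f' x + g' x :=
  ⟨hf.1.add hg.1, hf.2.add hg.2, fun x hx => by
    rw [add_div]; exact (hf.3 x hx).add (hg.3 x hx)⟩

theorem EulerPair.mul {f f' g g' : ℝ → ℝ} (hf : EulerPair f f') (hg : EulerPair g g') :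
    EulerPair (fun x => f x * g x) fun x => f' x * g x + f x * g' x :=
  ⟨hf.1.mul hg.1, (hf.2.mul hg.1).add (hf.1.mul hg.2), fun x hx => by
    refine ((hf.3 x hx).mul (hg.3 x hx)).congr_deriv ?_
    ring⟩

theorem EulerPair.sum {κ : Type*} {f f' : κ → ℝ → ℝ} (s : Finset κ)
    (h : ∀ i ∈ s, EulerPair (f i) (f' i)) :
    EulerPair (fun x => ∑ i ∈ s, f i x) fun x => ∑ i ∈ s, f' i x := by
  classical
  induction s using Finset.induction_on with
  | empty => simpa using EulerPair.const 0
  | insert a s ha ih =>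
    simp only [Finset.sum_insert ha]
    exact (h a (by simp)).add (ih fun i hi => h i (by simp [hi]))

theorem EulerPair.exists_prod {κ : Type*} {f f' : κ → ℝ → ℝ} (s : Finset κ)
    (h : ∀ i ∈ s, EulerPair (f i) (f' i)) :
    ∃ F, EulerPair (fun x => ∏ i ∈ s, f i x) F := by
  classical
  induction s using Finset.induction_on with
  | empty => exact ⟨_, by simpa using EulerPair.const 1⟩
  | insert a s ha ih =>
    obtain ⟨F, hF⟩ := ih fun i hi => h i (by simp [hi])
    simp only [Finset.prod_insert ha]
    exact ⟨_, (h a (by simp)).mul hF⟩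

/-- Integration by parts on the half line. -/
theorem EulerPair.integral_eq {g g' : ℝ → ℝ} (h : EulerPair g g') :
    ∫ x in Ioi (0 : ℝ), (g' x - x * g x) * Real.exp (-x) =
      -∫ x in Ioi (0 : ℝ), g x * Real.exp (-x) := by
  have hid : Moderate fun x => x := by simpa using Moderate.rpow zero_le_one
  have hm : Moderate fun x => x * g x := hid.mul h.1
  have hm' : Moderate fun x => g' x - x * g x := by
    simpa [sub_eq_add_neg] using h.2.add ((Moderate.const (-1)).mul hm)
  have hder : ∀ x ∈ Ioi (0 : ℝ), HasDerivAt (fun x => x * g x * Real.exp (-x))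
      ((g' x - x * g x) * Real.exp (-x) + g x * Real.exp (-x)) x := by
    intro x hx
    refine (((hasDerivAt_id' x).mul (h.3 x hx)).mul ((hasDerivAt_neg x).exp)).congr_deriv ?_
    have : x ≠ 0 := ne_of_gt hx
    simp only [Pi.mul_apply]
    field_simp
    ring
  have hint := hm'.integrableOn.add h.1.integrableOn
  -- The boundary term at $0$ vanishes because $|x\,g(x)|\le Cx^{1/2}(1+x)^N$.
  have hcont : ContinuousWithinAt (fun x => x * g x * Real.exp (-x)) (Ici 0) 0 := by
    obtain ⟨C, N, hC, hb⟩ := h.1.2 (1 / 2) (by norm_num)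
    have hlim : Tendsto (fun x : ℝ => C * (x ^ (1 / 2 : ℝ) * (1 + x) ^ N) * Real.exp (-x))
        (𝓝[Ici 0] 0) (𝓝 0) := by
      have : Continuous fun x : ℝ => C * (x ^ (1 / 2 : ℝ) * (1 + x) ^ N) * Real.exp (-x) := by
        have := Real.continuous_rpow_const (q := 1 / 2) (by norm_num)
        fun_prop
      simpa using (this.tendsto 0).mono_left nhdsWithin_le_nhds
    rw [ContinuousWithinAt]
    simp only [zero_mul]
    refine squeeze_zero_norm' ?_ hlim
    filter_upwards [self_mem_nhdsWithin] with x hx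
    rcases eq_or_lt_of_le (show (0 : ℝ) ≤ x from hx) with rfl | hx
    · simp
    rw [norm_mul, norm_mul, Real.norm_eq_abs, Real.norm_eq_abs, Real.norm_eq_abs, Real.abs_exp,
      abs_of_pos hx]
    refine mul_le_mul_of_nonneg_right ?_ (Real.exp_pos _).le
    refine (mul_le_mul_of_nonneg_left (hb x hx) hx.le).trans (le_of_eq ?_)
    have : x ^ (1 / 2 : ℝ) = x * x ^ (-(1 / 2) : ℝ) := by
      nth_rewrite 2 [← Real.rpow_one x]
      rw [← Real.rpow_add hx]; norm_num
    rw [this]; ring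
  -- At infinity no estimate is needed: an integrable function with integrable derivative tends to
  -- $0$.
  have hinf := tendsto_zero_of_hasDerivAt_of_integrableOn_Ioi hder hint hm.integrableOn
  have := integral_Ioi_of_hasDerivAt_of_tendsto hcont hder hint hinf
  have h2 := integral_add hm'.integrableOn h.1.integrableOn
  simp only [zero_mul, sub_zero] at this
  linarith [h2.symm.trans this]

end Moderate

/-! ### The divergence identity for dilations of the orthant. -/

section Orthant

variable {ι : Type*} [Fintype ι]

/-- The boundary faces are null, so pointwise identities are only needed at strictly positive
coordinates. -/
theorem restrict_orthant : (volume : Measure (ι → ℝ)).restrict (orthant ι) =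
    Measure.pi fun _ : ι => (volume : Measure ℝ).restrict (Set.Ioi 0) := by
  rw [← Measure.restrict_pi_pi, ← volume_pi]
  apply Measure.restrict_congr_set
  have h : orthant ι = Set.univ.pi fun _ => Set.Ici (0 : ℝ) := by
    ext x; simp only [orthant, Set.mem_ofPred_eq, Set.mem_univ_pi, Set.mem_Ici]
  rw [h]
  exact (Measure.pi_Ioi_ae_eq_pi_Ici (s := Set.univ) (f := fun _ : ι => (0 : ℝ))).symm

theorem measurableSet_orthant : MeasurableSet (orthant ι) := by
  have h : orthant ι = Set.univ.pi fun _ => Set.Ici (0 : ℝ) := by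
    ext x; simp only [orthant, Set.mem_ofPred_eq, Set.mem_univ_pi, Set.mem_Ici]
  rw [h]
  exact MeasurableSet.univ_pi fun _ => measurableSet_Ici

theorem ae_pos_orthant :
    ∀ᵐ x ∂(volume : Measure (ι → ℝ)).restrict (orthant ι), ∀ i, 0 < x i := by
  have : (volume : Measure (ι → ℝ)).restrict (orthant ι) =
      volume.restrict (Set.univ.pi fun _ => Set.Ioi (0 : ℝ)) := by
    rw [restrict_orthant, ← Measure.restrict_pi_pi, ← volume_pi]
  rw [this]
  refine (ae_restrict_iff' (MeasurableSet.univ_pi fun _ => measurableSet_Ioi)).2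
    (Filter.Eventually.of_forall fun x hx i => hx i (Set.mem_univ i))

theorem integral_orthant_prod (h : ι → ℝ → ℝ) :
    ∫ x in orthant ι, ∏ i, h i (x i) = ∏ i, ∫ x in Set.Ioi (0 : ℝ), h i x := by
  rw [restrict_orthant, integral_fintype_prod_eq_prod]

theorem integrableOn_orthant_prod {h : ι → ℝ → ℝ}
    (hh : ∀ i, IntegrableOn (h i) (Set.Ioi 0)) :
    IntegrableOn (fun x : ι → ℝ => ∏ i, h i (x i)) (orthant ι) := by
  rw [IntegrableOn, restrict_orthant]
  exact Integrable.fintype_prod hh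

/-- `G` is integrable over the orthant, together with its Euler derivative, and the integral of
`∑_i ∂_i (x_i G)` vanishes. -/
def EulerNull (G : (ι → ℝ) → ℝ) : Prop :=
  ∃ G' : (ι → ℝ) → ℝ,
    (∀ x, (∀ i, 0 < x i) → HasDerivAt (fun θ : ℝ => G (θ • x)) (G' x) 1) ∧
    IntegrableOn G (orthant ι) ∧ IntegrableOn G' (orthant ι) ∧
    ∫ x in orthant ι, G' x = -(Fintype.card ι) * ∫ x in orthant ι, G x

theorem EulerNull.integrableOn {G : (ι → ℝ) → ℝ} (hG : EulerNull G) :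
    IntegrableOn G (orthant ι) := by
  obtain ⟨_, -, h, -⟩ := hG
  exact h

/-- Derivatives are unique, so nullity proved from an expansion into products can be applied to a
derivative computed in closed form. -/
theorem EulerNull.integral_eq {G G' : (ι → ℝ) → ℝ} (hG : EulerNull G)
    (h : ∀ x, (∀ i, 0 < x i) → HasDerivAt (fun θ : ℝ => G (θ • x)) (G' x) 1) :
    IntegrableOn G' (orthant ι) ∧
      ∫ x in orthant ι, G' x = -(Fintype.card ι) * ∫ x in orthant ι, G x := by
  obtain ⟨G₁, h₁, -, h₂, h₃⟩ := hG
  have : G₁ =ᵐ[volume.restrict (orthant ι)] G' := by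
    filter_upwards [ae_pos_orthant] with x hx using (h₁ x hx).unique (h x hx)
  exact ⟨h₂.congr this, by rw [← h₃, integral_congr_ae this]⟩

theorem EulerNull.congr {G H : (ι → ℝ) → ℝ} (hG : EulerNull G)
    (h : ∀ x, (∀ i, 0 < x i) → H x = G x) : EulerNull H := by
  obtain ⟨G', h₁, h₂, h₃, h₄⟩ := hG
  have hae : G =ᵐ[volume.restrict (orthant ι)] H := by
    filter_upwards [ae_pos_orthant] with x hx using (h x hx).symm
  refine ⟨G', fun x hx => (h₁ x hx).congr_of_eventuallyEq ?_, h₂.congr hae, h₃, ?_⟩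
  · filter_upwards [lt_mem_nhds (zero_lt_one' ℝ)] with θ hθ
    exact h _ fun i => by simpa using mul_pos hθ (hx i)
  · rw [h₄, integral_congr_ae hae]

theorem EulerNull.zero : EulerNull fun _ : ι → ℝ => (0 : ℝ) :=
  ⟨fun _ => 0, fun x _ => hasDerivAt_const _ _, integrableOn_zero, integrableOn_zero, by simp⟩

theorem EulerNull.add {G H : (ι → ℝ) → ℝ} (hG : EulerNull G) (hH : EulerNull H) :
    EulerNull fun x => G x + H x := by
  obtain ⟨G', h₁, h₂, h₃, h₄⟩ := hG
  obtain ⟨H', k₁, k₂, k₃, k₄⟩ := hH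
  refine ⟨fun x => G' x + H' x, fun x hx => (h₁ x hx).add (k₁ x hx), h₂.add k₂, h₃.add k₃, ?_⟩
  rw [integral_add h₃ k₃, integral_add h₂ k₂, h₄, k₄]
  ring

theorem EulerNull.const_mul {G : (ι → ℝ) → ℝ} (c : ℝ) (hG : EulerNull G) :
    EulerNull fun x => c * G x := by
  obtain ⟨G', h₁, h₂, h₃, h₄⟩ := hG
  refine ⟨fun x => c * G' x, fun x hx => (h₁ x hx).const_mul c, h₂.const_mul c, h₃.const_mul c, ?_⟩
  rw [integral_const_mul, integral_const_mul, h₄]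
  ring

theorem EulerNull.sum {κ : Type*} (s : Finset κ) {G : κ → (ι → ℝ) → ℝ}
    (h : ∀ i ∈ s, EulerNull (G i)) : EulerNull fun x => ∑ i ∈ s, G i x := by
  classical
  induction s using Finset.induction_on with
  | empty => simpa using EulerNull.zero
  | insert a s ha ih =>
    simp only [Finset.sum_insert ha]
    exact (h a (by simp)).add (ih fun i hi => h i (by simp [hi]))

/-- Each coordinate is integrated by parts separately and contributes $-\int G$. Moments and cyclic
kernel products are finite sums of such products. -/
theorem EulerNull.prod {g g' : ι → ℝ → ℝ} (h : ∀ i, EulerPair (g i) (g' i)) :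
    EulerNull fun x : ι → ℝ => ∏ i, (g i (x i) * Real.exp (-x i)) := by
  classical
  have hid : Moderate fun x => x := by simpa using Moderate.rpow zero_le_one
  have hm' : ∀ i, Moderate fun x => g' i x - x * g i x := fun i => by
    simpa [sub_eq_add_neg] using (h i).2.add ((Moderate.const (-1)).mul (hid.mul (h i).1))
  set k : ι → ι → ℝ → ℝ := fun i j => if j = i then fun x => (g' j x - x * g j x) * Real.exp (-x)
    else fun x => g j x * Real.exp (-x) with hk
  have hkint : ∀ i j, IntegrableOn (k i j) (Set.Ioi 0) := fun i j => by
    by_cases hij : j = i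
    · simp only [hk, hij, if_true]; exact (hm' i).integrableOn
    · simp only [hk, hij, if_false]; exact (h j).1.integrableOn
  refine ⟨fun x => ∑ i, ∏ j, k i j (x j), fun x hx => ?_,
    integrableOn_orthant_prod fun i => (h i).1.integrableOn,
    integrable_finsetSum _ fun i _ => integrableOn_orthant_prod (hkint i), ?_⟩
  · have hder : ∀ i ∈ (Finset.univ : Finset ι), HasDerivAt
        (fun θ : ℝ => g i ((θ • x) i) * Real.exp (-(θ • x) i)) (k i i (x i)) 1 := fun i _ => by
      have h1 : HasDerivAt (fun θ : ℝ => θ * x i) (x i) 1 := by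
        simpa using (hasDerivAt_id (1 : ℝ)).mul_const (x i)
      have h2 : HasDerivAt (fun y => g i y * Real.exp (-y))
          (g' i (x i) / x i * Real.exp (-x i) + g i (x i) * (Real.exp (-x i) * -1)) (1 * x i) := by
        rw [one_mul]
        exact ((h i).3 _ (hx i)).mul (hasDerivAt_neg _).exp
      have h3 := h2.comp 1 h1
      refine h3.congr_deriv ?_
      have := (hx i).ne'
      simp only [hk, if_true]
      field_simp
      ring
    have := HasDerivAt.fun_finsetProd hder
    refine this.congr_deriv ?_
    refine Finset.sum_congr rfl fun i _ => ?_
    rw [← Finset.prod_erase_mul _ _ (Finset.mem_univ i), smul_eq_mul]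
    congr 1
    refine Finset.prod_congr rfl fun j hj => ?_
    simp [hk, Finset.ne_of_mem_erase hj]
  · rw [integral_finsetSum _ fun i _ => integrableOn_orthant_prod (hkint i),
      integral_orthant_prod (fun i x => g i x * Real.exp (-x))]
    have : ∀ i, ∫ x in orthant ι, ∏ j, k i j (x j) =
        -∏ j, ∫ x in Set.Ioi (0 : ℝ), g j x * Real.exp (-x) := fun i => by
      rw [integral_orthant_prod (k i), ← Finset.mul_prod_erase _ _ (Finset.mem_univ i),
        ← Finset.mul_prod_erase _ (fun j => ∫ x in Set.Ioi (0 : ℝ), g j x * Real.exp (-x))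
          (Finset.mem_univ i), ← neg_mul, ← (h i).integral_eq]
      congr 1
      · simp [hk]
      · refine Finset.prod_congr rfl fun j hj => ?_
        simp [hk, Finset.ne_of_mem_erase hj]
    simp [this]

end Orthant

/-! ### Laguerre polynomials: Euler derivative, Christoffel-Darboux sum, orthogonality. -/

section Laguerre

/-- The coefficient of `x^j` in `L_n^{(α)}`. -/
noncomputable def laguerreCoeff (n : ℕ) (α : ℝ) (j : ℕ) : ℝ :=
  (-1) ^ j * n.choose j * (Real.Gamma (n + α + 1) / (n.factorial * Real.Gamma (α + j + 1)))

theorem laguerreCoeff_eq_zero {n j : ℕ} (α : ℝ) (h : n < j) : laguerreCoeff n α j = 0 := by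
  simp [laguerreCoeff, Nat.choose_eq_zero_of_lt h]

theorem laguerreL_eq_sum {n N : ℕ} (α x : ℝ) (h : n < N) :
    laguerreL n α x = ∑ j ∈ Finset.range N, laguerreCoeff n α j * x ^ j := by
  rw [laguerreL]
  have h1 : Finset.range (n + 1) ⊆ Finset.range N := Finset.range_mono h
  rw [← Finset.sum_subset h1 (fun j _ hj => by
    rw [laguerreCoeff_eq_zero α (by simpa using hj), zero_mul])]
  refine Finset.sum_congr rfl fun j hj => ?_
  have hjn : j ≤ n := by simpa [Nat.lt_succ_iff] using hj
  rw [laguerreCoeff, Nat.cast_choose ℝ hjn]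
  have := Nat.factorial_ne_zero n
  congr 1
  field_simp

/-- The Euler derivative `x d/dx` of `L_n^{(α)}`. -/
noncomputable def laguerreE (n : ℕ) (α x : ℝ) : ℝ :=
  ∑ j ∈ Finset.range (n + 1), laguerreCoeff n α j * (j * x ^ j)

theorem laguerreE_eq_sum {n N : ℕ} (α x : ℝ) (h : n < N) :
    laguerreE n α x = ∑ j ∈ Finset.range N, laguerreCoeff n α j * (j * x ^ j) := by
  rw [laguerreE]
  exact Finset.sum_subset (Finset.range_mono h) fun j _ hj => by
    rw [laguerreCoeff_eq_zero α (by simpa using hj), zero_mul]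

theorem EulerPair.const_mul {g g' : ℝ → ℝ} (c : ℝ) (h : EulerPair g g') :
    EulerPair (fun x => c * g x) fun x => c * g' x := by
  simpa using (EulerPair.const c).mul h

theorem eulerPair_laguerreL (n : ℕ) (α : ℝ) : EulerPair (laguerreL n α) (laguerreE n α) := by
  have := EulerPair.sum (Finset.range (n + 1)) fun j _ =>
    (EulerPair.pow j).const_mul (laguerreCoeff n α j)
  have e : laguerreL n α = fun x => ∑ j ∈ Finset.range (n + 1), laguerreCoeff n α j * x ^ j :=
    funext fun x => laguerreL_eq_sum α x (Nat.lt_succ_self n)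
  rw [e]
  exact this

theorem gamma_pos_of_nonneg {α : ℝ} (hα : 0 ≤ α) (j : ℕ) : 0 < Real.Gamma (α + j + 1) :=
  Real.Gamma_pos_of_pos (by positivity)

theorem gamma_succ {α : ℝ} (hα : 0 ≤ α) (n : ℕ) :
    Real.Gamma ((n + 1 : ℕ) + α + 1) = (n + 1 + α) * Real.Gamma (n + α + 1) := by
  rw [show ((n + 1 : ℕ) : ℝ) + α + 1 = (n + α + 1) + 1 by push_cast; ring,
    Real.Gamma_add_one (by positivity)]
  ring

/-- Comparison of coefficients via $\binom nj(n+1)=\binom{n+1}j(n+1-j)$. It lowers the degree and is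
the partner of `laguerreE_eq`, which raises it. -/
theorem laguerreE_succ {α : ℝ} (hα : 0 ≤ α) (n : ℕ) (x : ℝ) :
    laguerreE (n + 1) α x =
      (n + 1) * laguerreL (n + 1) α x - (n + 1 + α) * laguerreL n α x := by
  rw [laguerreE, laguerreL_eq_sum α x (Nat.lt_succ_self (n + 1)),
    laguerreL_eq_sum (N := n + 2) α x (by omega), Finset.mul_sum, Finset.mul_sum,
    ← Finset.sum_sub_distrib]
  refine Finset.sum_congr rfl fun j hj => ?_
  have hj' : j ≤ n + 1 := by simpa [Nat.lt_succ_iff] using hj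
  have hc : (n.choose j : ℝ) * (n + 1) = ((n + 1).choose j : ℝ) * (n + 1 - j) := by
    have := Nat.choose_mul_succ_eq n j
    have h2 : ((n + 1 - j : ℕ) : ℝ) = n + 1 - j := by push_cast [Nat.cast_sub hj']; ring
    rw [← h2]; exact_mod_cast this
  have hG := (gamma_pos_of_nonneg hα j).ne'
  rw [laguerreCoeff, laguerreCoeff, gamma_succ hα, Nat.factorial_succ]
  have := Nat.factorial_ne_zero n
  have hn : (n : ℝ) + 1 ≠ 0 := by positivity
  push_cast
  field_simp
  linear_combination x ^ j * hc

theorem laguerreE_eq {α : ℝ} (hα : 0 ≤ α) (n : ℕ) (x : ℝ) :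
    laguerreE n α x =
      (n + 1) * laguerreL (n + 1) α x - (n + 1 + α - x) * laguerreL n α x := by
  have hx : x * laguerreL n α x =
      ∑ j ∈ Finset.range (n + 1), laguerreCoeff n α j * x ^ (j + 1) := by
    rw [laguerreL_eq_sum α x (Nat.lt_succ_self n), Finset.mul_sum]
    exact Finset.sum_congr rfl fun j _ => by ring
  have key : laguerreE n α x + (n + 1 + α) * laguerreL n α x - (n + 1) * laguerreL (n + 1) α x =
      x * laguerreL n α x := by
    rw [hx, laguerreE_eq_sum (N := n + 2) α x (by omega),
      laguerreL_eq_sum α x (Nat.lt_succ_self (n + 1)),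
      laguerreL_eq_sum (N := n + 2) α x (by omega), Finset.mul_sum, Finset.mul_sum,
      ← Finset.sum_add_distrib, ← Finset.sum_sub_distrib, Finset.sum_range_succ']
    have hfn := Nat.factorial_ne_zero n
    have hn : (n : ℝ) + 1 ≠ 0 := by positivity
    have h0 : laguerreCoeff n α 0 * ((0 : ℕ) * x ^ 0) + (n + 1 + α) * (laguerreCoeff n α 0 * x ^ 0)
        - (n + 1) * (laguerreCoeff (n + 1) α 0 * x ^ 0) = 0 := by
      have hG := (gamma_pos_of_nonneg hα 0).ne'
      rw [laguerreCoeff, laguerreCoeff, gamma_succ hα, Nat.factorial_succ]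
      push_cast at hG ⊢
      simp only [Nat.choose_zero_right]
      field_simp
      ring
    rw [h0, add_zero]
    refine Finset.sum_congr rfl fun j hj => ?_
    have hj' : j ≤ n := by simpa [Nat.lt_succ_iff] using hj
    have hc : (n.choose (j + 1) : ℝ) * (j + 1) = (n.choose j : ℝ) * (n - j) := by
      rw [← Nat.cast_sub hj']; exact_mod_cast Nat.choose_succ_right_eq n j
    have hG := (gamma_pos_of_nonneg hα j).ne'
    have hG' : Real.Gamma (α + (j + 1 : ℕ) + 1) = (α + j + 1) * Real.Gamma (α + j + 1) := by
      rw [← Real.Gamma_add_one (by positivity)]; congr 1; push_cast; ring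
    have hne : α + j + 1 ≠ 0 := by positivity
    rw [laguerreCoeff, laguerreCoeff, laguerreCoeff, gamma_succ hα, Nat.factorial_succ, hG',
      Nat.choose_succ_succ]
    push_cast
    field_simp
    linear_combination -x ^ (j + 1) * (-1) ^ j * hc
  linear_combination key

theorem laguerreL_zero {α : ℝ} (hα : 0 ≤ α) (x : ℝ) : laguerreL 0 α x = 1 := by
  have := (gamma_pos_of_nonneg hα 0).ne'
  simp only [Nat.cast_zero, add_zero] at this
  simp [laguerreL, this]

/-- The Euler operator turns the Christoffel-Darboux sum into the decoupled kernel. -/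
theorem euler_christoffelDarboux {α : ℝ} (hα : 0 ≤ α) {m : ℕ} (hm : 1 ≤ m) (x y : ℝ) :
    ∑ n ∈ Finset.range m, (n.factorial : ℝ) / Real.Gamma (n + α + 1) *
        (laguerreE n α x * laguerreL n α y + laguerreL n α x * laguerreE n α y) +
      (1 + α - (x + y) / 2) * ∑ n ∈ Finset.range m, (n.factorial : ℝ) / Real.Gamma (n + α + 1) *
        (laguerreL n α x * laguerreL n α y) =
      m.factorial / (2 * Real.Gamma (m + α)) *
        (laguerreL m α x * laguerreL (m - 1) α y + laguerreL (m - 1) α x * laguerreL m α y) := by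
  induction m, hm using Nat.le_induction with
  | base =>
    have hG := (gamma_pos_of_nonneg hα 0).ne'
    have hx := laguerreE_eq hα 0 x
    have hy := laguerreE_eq hα 0 y
    have h0 : ∀ z, laguerreE 0 α z = 0 := fun z => by simp [laguerreE]
    rw [h0, laguerreL_zero hα] at hx hy
    have e : Real.Gamma ((1 : ℕ) + α) = Real.Gamma ((0 : ℕ) + α + 1) := by
      congr 1; push_cast; ring
    simp only [Nat.cast_zero, add_zero, zero_add] at hG hx hy
    rw [e]
    simp only [Finset.sum_range_one, h0, laguerreL_zero hα, Nat.factorial, Nat.cast_zero,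
      zero_add, Nat.sub_self, Nat.cast_one, mul_one]
    field_simp
    linear_combination hx + hy
  | succ m hm ih =>
    obtain ⟨k, rfl⟩ := Nat.exists_eq_add_of_le' hm
    rw [Finset.sum_range_succ _ (k + 1), Finset.sum_range_succ _ (k + 1)]
    have hx1 := laguerreE_succ hα k x
    have hy1 := laguerreE_succ hα k y
    have hx2 := laguerreE_eq hα (k + 1) x
    have hy2 := laguerreE_eq hα (k + 1) y
    have hG1 : Real.Gamma ((k + 1 : ℕ) + α) ≠ 0 := (Real.Gamma_pos_of_pos (by positivity)).ne'
    have hG2 : Real.Gamma ((k + 1 : ℕ) + α + 1) = (k + 1 + α) * Real.Gamma ((k + 1 : ℕ) + α) := by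
      rw [Real.Gamma_add_one (by positivity)]; push_cast; ring
    have hG3 : Real.Gamma ((k + 1 + 1 : ℕ) + α) = (k + 1 + α) * Real.Gamma ((k + 1 : ℕ) + α) := by
      rw [← hG2]; congr 1; push_cast; ring
    have hne : (k : ℝ) + 1 + α ≠ 0 := by positivity
    simp only [Nat.add_sub_cancel] at ih ⊢
    rw [hG2, hG3, Nat.factorial_succ (k + 1)]
    set F : ℝ := ((k + 1).factorial : ℝ)
    set G := Real.Gamma ((k + 1 : ℕ) + α)
    push_cast at hx2 hy2 ⊢
    -- The average of the two relations is what is needed: in the sum over $x$ and $y$ its middle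
    -- terms cancel $1+\alpha-(x+y)/2$ exactly, and the rest telescopes.
    have e1 : laguerreE (k + 1) α x = ((k + 1 + 1) * laguerreL (k + 1 + 1) α x -
        (k + 1 + α) * laguerreL k α x - (1 + α - x) * laguerreL (k + 1) α x) / 2 := by
      linear_combination (hx1 + hx2) / 2
    have e2 : laguerreE (k + 1) α y = ((k + 1 + 1) * laguerreL (k + 1 + 1) α y -
        (k + 1 + α) * laguerreL k α y - (1 + α - y) * laguerreL (k + 1) α y) / 2 := by
      linear_combination (hy1 + hy2) / 2
    rw [e1, e2]
    have hF : F / G = (k + 1 + α) * (F / ((k + 1 + α) * G)) := by field_simp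
    have hF2 : F / (2 * G) = (k + 1 + α) * (F / ((k + 1 + α) * G)) / 2 := by field_simp
    have hF3 : (k + 1 + 1) * F / (2 * ((k + 1 + α) * G)) =
        (k + 1 + 1) * (F / ((k + 1 + α) * G)) / 2 := by field_simp
    rw [hF2] at ih
    rw [hF3]
    linear_combination ih

/-- The moments of the Laguerre weight. -/
theorem integral_pow_mul_weight {α : ℝ} (hα : 0 ≤ α) (j : ℕ) :
    ∫ x in Set.Ioi (0 : ℝ), x ^ j * x ^ α * Real.exp (-x) = Real.Gamma (α + j + 1) := by
  rw [Real.Gamma_eq_integral (by positivity)]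
  refine setIntegral_congr_fun measurableSet_Ioi fun x (hx : 0 < x) => ?_
  rw [← Real.rpow_natCast, ← Real.rpow_add hx, mul_comm]
  congr 2
  ring

theorem integrableOn_pow_mul_weight {α : ℝ} (hα : 0 ≤ α) (j : ℕ) :
    IntegrableOn (fun x : ℝ => x ^ j * x ^ α * Real.exp (-x)) (Set.Ioi 0) :=
  ((EulerPair.pow j).mul (EulerPair.rpow hα)).moderate.integrableOn

theorem gamma_add_nat {s : ℝ} (hs : 0 < s) (j : ℕ) :
    Real.Gamma (s + j) = (ascPochhammer ℝ j).eval s * Real.Gamma s := by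
  induction j with
  | zero => simp
  | succ j ih =>
    rw [Nat.cast_succ, ← add_assoc, Real.Gamma_add_one (by positivity), ih,
      ascPochhammer_succ_eval]
    ring

/-- $\Gamma(\alpha+i+j+1)=(\alpha+i+1)_j\,\Gamma(\alpha+i+1)$, and the last factor cancels against
the coefficient of $x^i$. What remains is an alternating binomial sum of a monic polynomial of
degree $j$ in $i$, that is, an $n$-th difference: it vanishes for $j<n$ and is $n!$ for $j=n$. -/
theorem integral_pow_mul_laguerreL_eq_sum {α : ℝ} (hα : 0 ≤ α) (n j : ℕ) :
    ∫ x in Set.Ioi (0 : ℝ), x ^ j * laguerreL n α x * x ^ α * Real.exp (-x) =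
      Real.Gamma (n + α + 1) / n.factorial * ((-1) ^ n *
        (fwdDiff 1)^[n] ((ascPochhammer ℝ j).comp (Polynomial.X + Polynomial.C (α + 1))).eval 0) := by
  have h1 : ∀ x : ℝ, x ^ j * laguerreL n α x * x ^ α * Real.exp (-x) =
      ∑ i ∈ Finset.range (n + 1),
        laguerreCoeff n α i * (x ^ (i + j) * x ^ α * Real.exp (-x)) := fun x => by
    rw [laguerreL_eq_sum α x (Nat.lt_succ_self n), Finset.mul_sum, Finset.sum_mul, Finset.sum_mul]
    exact Finset.sum_congr rfl fun i _ => by ring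
  simp only [h1]
  rw [integral_finsetSum _ fun i _ => (integrableOn_pow_mul_weight hα (i + j)).const_mul _,
    fwdDiff_iter_eq_sum_shift, Finset.mul_sum, Finset.mul_sum]
  refine Finset.sum_congr rfl fun i hi => ?_
  have hi' : i ≤ n := by simpa [Nat.lt_succ_iff] using hi
  have hG := (gamma_pos_of_nonneg hα i).ne'
  have hs : (-1 : ℝ) ^ i = (-1) ^ n * (-1) ^ (n - i) := by
    rw [← pow_add, show n + (n - i) = i + 2 * (n - i) by omega, pow_add, pow_mul]
    simp
  rw [integral_const_mul, integral_pow_mul_weight hα,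
    show α + ((i + j : ℕ) : ℝ) + 1 = (α + i + 1) + j by push_cast; ring,
    gamma_add_nat (by positivity), laguerreCoeff, hs]
  have he : ((ascPochhammer ℝ j).comp (Polynomial.X + Polynomial.C (α + 1))).eval (0 + i • (1 : ℝ))
      = (ascPochhammer ℝ j).eval (α + i + 1) := by
    rw [Polynomial.eval_comp]
    congr 1
    simp
    ring
  rw [he, zsmul_eq_mul]
  have := Nat.factorial_ne_zero n
  push_cast
  field_simp

theorem natDegree_shifted_ascPochhammer (α : ℝ) (j : ℕ) :
    ((ascPochhammer ℝ j).comp (Polynomial.X + Polynomial.C (α + 1))).natDegree = j := by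
  rw [Polynomial.natDegree_comp, ascPochhammer_natDegree, Polynomial.natDegree_X_add_C, mul_one]

theorem integral_pow_mul_laguerreL_of_lt {α : ℝ} (hα : 0 ≤ α) {n j : ℕ} (hj : j < n) :
    ∫ x in Set.Ioi (0 : ℝ), x ^ j * laguerreL n α x * x ^ α * Real.exp (-x) = 0 := by
  rw [integral_pow_mul_laguerreL_eq_sum hα, Polynomial.fwdDiff_iter_eq_zero_of_degree_lt]
  · simp
  · rwa [natDegree_shifted_ascPochhammer]

theorem integral_pow_mul_laguerreL_self {α : ℝ} (hα : 0 ≤ α) (n : ℕ) :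
    ∫ x in Set.Ioi (0 : ℝ), x ^ n * laguerreL n α x * x ^ α * Real.exp (-x) =
      (-1) ^ n * Real.Gamma (n + α + 1) := by
  have h := Polynomial.fwdDiff_iter_degree_eq_factorial
    ((ascPochhammer ℝ n).comp (Polynomial.X + Polynomial.C (α + 1)))
  have hmon : ((ascPochhammer ℝ n).comp (Polynomial.X + Polynomial.C (α + 1))).leadingCoeff = 1 :=
    (monic_ascPochhammer ℝ n).comp (Polynomial.monic_X_add_C _)
      (by rw [Polynomial.natDegree_X_add_C]; exact one_ne_zero)
  rw [natDegree_shifted_ascPochhammer, hmon] at h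
  rw [integral_pow_mul_laguerreL_eq_sum hα, h]
  have := Nat.factorial_ne_zero n
  simp
  field_simp

theorem integral_laguerreL_mul_laguerreL {α : ℝ} (hα : 0 ≤ α) (a b : ℕ) :
    ∫ x in Set.Ioi (0 : ℝ), laguerreL a α x * laguerreL b α x * x ^ α * Real.exp (-x) =
      if a = b then Real.Gamma (a + α + 1) / a.factorial else 0 := by
  wlog hab : a ≤ b generalizing a b
  · have := this b a (by omega)
    simp only [mul_comm (laguerreL b α _)] at this
    rw [this]
    by_cases h : a = b
    · subst h; rfl
    · rw [if_neg h, if_neg (Ne.symm h)]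
  have h1 : ∀ x : ℝ, laguerreL a α x * laguerreL b α x * x ^ α * Real.exp (-x) =
      ∑ i ∈ Finset.range (a + 1),
        laguerreCoeff a α i * (x ^ i * laguerreL b α x * x ^ α * Real.exp (-x)) := fun x => by
    rw [laguerreL_eq_sum α x (Nat.lt_succ_self a), Finset.sum_mul, Finset.sum_mul, Finset.sum_mul]
    exact Finset.sum_congr rfl fun i _ => by ring
  simp only [h1]
  rw [integral_finsetSum _ fun i _ => (Moderate.integrableOn (((Moderate.mul
    (EulerPair.pow i).moderate (eulerPair_laguerreL b α).moderate)).mul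
      (Moderate.rpow hα))).const_mul _, Finset.sum_range_succ, Finset.sum_eq_zero]
  · rw [integral_const_mul, zero_add]
    rcases eq_or_lt_of_le hab with rfl | hlt
    · rw [if_pos rfl, integral_pow_mul_laguerreL_self hα, laguerreCoeff]
      have := (gamma_pos_of_nonneg hα a).ne'
      have h2 : ((-1 : ℝ) ^ a) ^ 2 = 1 := by rw [← pow_mul, mul_comm, pow_mul]; simp
      have h3 : Real.Gamma (a + α + 1) = Real.Gamma (α + a + 1) := by rw [add_comm (a : ℝ)]
      have := Nat.factorial_ne_zero a
      rw [h3, Nat.choose_self]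
      field_simp
      rw [h2]; simp
    · rw [if_neg hlt.ne, integral_pow_mul_laguerreL_of_lt hα hlt, mul_zero]
  · intro i hi
    rw [integral_const_mul, integral_pow_mul_laguerreL_of_lt hα, mul_zero]
    rw [Finset.mem_range] at hi
    omega

end Laguerre

theorem SetFun.intCast_mul_apply {ι : Type*} [DecidableEq ι] (z : ℤ) (u : SetFun ι)
    (S : Finset ι) : ((z : SetFun ι) * u) S = z * u S := by
  rw [← zsmul_eq_mul, ← Int.cast_smul_eq_zsmul ℝ]
  rfl

/-! ### The ensemble as a determinantal process: moments as determinants. -/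

section Ensemble

variable {m : ℕ} {α : ℝ} {ι : Type*}

/-- The orthonormal Laguerre polynomials. -/
noncomputable def laguerreQ (n : ℕ) (α x : ℝ) : ℝ :=
  Real.sqrt (n.factorial / Real.Gamma (n + α + 1)) * laguerreL n α x

theorem laguerreNorm_pos (hα : 0 ≤ α) (n : ℕ) :
    0 < (n.factorial : ℝ) / Real.Gamma (n + α + 1) :=
  div_pos (by positivity) (Real.Gamma_pos_of_pos (by positivity))

theorem eulerPair_laguerreQ (n : ℕ) (α : ℝ) : ∃ g, EulerPair (laguerreQ n α) g :=
  ⟨_, (eulerPair_laguerreL n α).const_mul _⟩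

theorem moderate_laguerreQ (n : ℕ) (α : ℝ) : Moderate (laguerreQ n α) := by
  obtain ⟨g, hg⟩ := eulerPair_laguerreQ n α
  exact hg.moderate

theorem Moderate.prod {κ : Type*} {f : κ → ℝ → ℝ} (s : Finset κ) (h : ∀ i ∈ s, Moderate (f i)) :
    Moderate fun x => ∏ i ∈ s, f i x := by
  classical
  induction s using Finset.induction_on with
  | empty => simpa using Moderate.const 1
  | insert a s ha ih =>
    simp only [Finset.prod_insert ha]
    exact (h a (by simp)).mul (ih fun i hi => h i (by simp [hi]))

theorem integral_laguerreQ (hα : 0 ≤ α) (a b : ℕ) :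
    ∫ x in Set.Ioi (0 : ℝ), laguerreQ a α x * laguerreQ b α x * x ^ α * Real.exp (-x) =
      if a = b then 1 else 0 := by
  have h : ∀ x : ℝ, laguerreQ a α x * laguerreQ b α x * x ^ α * Real.exp (-x) =
      (Real.sqrt (a.factorial / Real.Gamma (a + α + 1)) *
        Real.sqrt (b.factorial / Real.Gamma (b + α + 1))) *
      (laguerreL a α x * laguerreL b α x * x ^ α * Real.exp (-x)) := fun x => by
    rw [laguerreQ, laguerreQ]; ring
  simp only [h]
  rw [integral_const_mul, integral_laguerreL_mul_laguerreL hα]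
  split_ifs with hab
  · subst hab
    rw [Real.mul_self_sqrt (laguerreNorm_pos hα a).le]
    have := (Real.Gamma_pos_of_pos (show 0 < (a : ℝ) + α + 1 by positivity)).ne'
    have := Nat.factorial_ne_zero a
    field_simp
  · simp

/-- The matrix of set functions `B ↦ ∫ ∏_{j ∈ B} f_j φ_a φ_b`, where the `φ_a` are the
orthonormal Laguerre functions. -/
noncomputable def laguerreGram (m : ℕ) (α : ℝ) (f : ι → ℝ → ℝ) :
    Matrix (Fin m) (Fin m) (SetFun ι) := fun a b B =>
  ∫ x in Set.Ioi (0 : ℝ), (∏ j ∈ B, f j x) * laguerreQ a α x * laguerreQ b α x * x ^ α *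
    Real.exp (-x)

theorem laguerreGram_empty (hα : 0 ≤ α) (f : ι → ℝ → ℝ) (a b : Fin m) :
    laguerreGram m α f a b ∅ = (1 : Matrix (Fin m) (Fin m) ℝ) a b := by
  have := integral_laguerreQ hα a b
  simp only [laguerreGram, Finset.prod_empty, one_mul, this, Matrix.one_apply, Fin.ext_iff]

/-- The polynomial `laguerreQ a` has degree exactly $a$, so the change of basis from monomials is
triangular with nonzero diagonal. The constant cancels in every normalized moment. -/
theorem exists_det_laguerreQ (hα : 0 ≤ α) (m : ℕ) : ∃ c : ℝ, c ≠ 0 ∧ ∀ x : Fin m → ℝ,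
    (Matrix.of fun a i : Fin m => laguerreQ a α (x i)).det =
      c * ∏ i : Fin m, ∏ j ∈ Finset.Ioi i, (x j - x i) := by
  set T : Matrix (Fin m) (Fin m) ℝ := Matrix.of fun j a =>
    Real.sqrt ((a : ℕ).factorial / Real.Gamma ((a : ℕ) + α + 1)) * laguerreCoeff a α j with hT
  refine ⟨T.det, ?_, fun x => ?_⟩
  · have htri : T.BlockTriangular id := fun j a (h : a < j) => by
      rw [hT, Matrix.of_apply, laguerreCoeff_eq_zero α (by exact_mod_cast h), mul_zero]
    rw [Matrix.det_of_isUpperTriangular htri, Finset.prod_ne_zero_iff]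
    intro a _
    rw [hT, Matrix.of_apply, laguerreCoeff, Nat.choose_self]
    have h1 := (Real.sqrt_pos.2 (laguerreNorm_pos hα a)).ne'
    have h2 := (gamma_pos_of_nonneg hα a).ne'
    have h3 : Real.Gamma ((a : ℕ) + α + 1) ≠ 0 := by rwa [add_comm ((a : ℕ) : ℝ)]
    have h4 := Nat.factorial_ne_zero (a : ℕ)
    have h5 : ((-1 : ℝ)) ^ (a : ℕ) ≠ 0 := by simp
    positivity
  · rw [← Matrix.det_vandermonde, mul_comm, ← Matrix.det_mul, ← Matrix.det_transpose]
    congr 1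
    ext i a
    rw [Matrix.transpose_apply, Matrix.of_apply, Matrix.mul_apply, laguerreQ,
      laguerreL_eq_sum α (x i) a.2, Finset.mul_sum, Finset.sum_range]
    refine Finset.sum_congr rfl fun j _ => ?_
    rw [Matrix.vandermonde_apply, hT, Matrix.of_apply]
    ring

theorem laguerreDensity_eq {c : ℝ} (hc : c ≠ 0) {x : Fin m → ℝ}
    (h : (Matrix.of fun a i : Fin m => laguerreQ a α (x i)).det =
      c * ∏ i : Fin m, ∏ j ∈ Finset.Ioi i, (x j - x i)) :
    laguerreDensity m α x = (c ^ 2)⁻¹ *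
      ((Matrix.of fun a i : Fin m => laguerreQ a α (x i)).det ^ 2 *
        ∏ i, (x i ^ α * Real.exp (-x i))) := by
  rw [h, laguerreDensity, mul_pow, ← Finset.prod_pow]
  simp only [← Finset.prod_pow]
  have e : ∀ i j, (x i - x j) ^ 2 = (x j - x i) ^ 2 := fun i j => by ring
  simp only [e]
  field_simp

/-- Expansion of the product of sums: each index $j\in S$ is allotted to one eigenvalue, $B_i$ being
the set allotted to $x_i$. The coefficient of the monomial product selects disjoint $B_i$ with union
`S`. -/
theorem prod_linearStatistic_eq [DecidableEq ι] [Fintype ι] (f : ι → ℝ → ℝ) (S : Finset ι)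
    (x : Fin m → ℝ) : ∏ j ∈ S, linearStatistic (f j) x =
      ∑ B : Fin m → Finset ι, (∏ i, SetFun.single (B i)) S * ∏ i, ∏ j ∈ B i, f j (x i) := by
  have h := SetFun.prod_expo Finset.univ fun (i : Fin m) (j : ι) => f j (x i)
  have h2 : (∏ i, SetFun.expo fun j => f j (x i)) S = SetFun.expo (∑ i, fun j => f j (x i)) S := by
    rw [h]
  rw [SetFun.prod_apply] at h2
  have h3 : SetFun.expo (∑ i, fun j => f j (x i)) S = ∏ j ∈ S, linearStatistic (f j) x := by
    simp [SetFun.expo, linearStatistic]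
  rw [← h3, ← h2]
  rfl

theorem laguerreDensity_mul_prod_eq [DecidableEq ι] [Fintype ι] {c : ℝ} (hc : c ≠ 0)
    {x : Fin m → ℝ}
    (h : (Matrix.of fun a i : Fin m => laguerreQ a α (x i)).det =
      c * ∏ i : Fin m, ∏ j ∈ Finset.Ioi i, (x j - x i)) (f : ι → ℝ → ℝ) (S : Finset ι) :
    laguerreDensity m α x * ∏ j ∈ S, linearStatistic (f j) x =
      (c ^ 2)⁻¹ * ∑ ρ : Equiv.Perm (Fin m), ∑ τ : Equiv.Perm (Fin m),
        ((ρ.sign : ℤ) : ℝ) * ((τ.sign : ℤ) : ℝ) * ∑ B : Fin m → Finset ι,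
          (∏ i, SetFun.single (B i)) S * ∏ i, ((∏ j ∈ B i, f j (x i)) * laguerreQ (ρ i) α (x i) *
            laguerreQ (τ i) α (x i) * x i ^ α * Real.exp (-x i)) := by
  rw [laguerreDensity_eq hc h, prod_linearStatistic_eq, mul_assoc, mul_assoc]
  congr 1
  rw [pow_two, Matrix.det_apply', Finset.sum_mul_sum, Finset.sum_mul]
  refine Finset.sum_congr rfl fun ρ _ => ?_
  rw [Finset.sum_mul]
  refine Finset.sum_congr rfl fun τ _ => ?_
  rw [Finset.mul_sum, Finset.mul_sum, Finset.mul_sum]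
  refine Finset.sum_congr rfl fun B _ => ?_
  simp only [Matrix.of_apply, Finset.prod_mul_distrib]
  ring

/-- For fixed `τ` the inner sum is the determinant with permuted columns, and the sign of `τ` occurs
twice. A general commutative ring is needed, as the entries will be set functions. -/
theorem sum_sign_mul_sign {R n : Type*} [CommRing R] [Fintype n] [DecidableEq n]
    (A : Matrix n n R) : ∑ ρ : Equiv.Perm n, ∑ τ : Equiv.Perm n,
      ((ρ.sign : ℤ) : R) * ((τ.sign : ℤ) : R) * ∏ i, A (ρ i) (τ i) =
        (Fintype.card n).factorial * A.det := by
  rw [Finset.sum_comm]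
  have h : ∀ τ : Equiv.Perm n, ∑ ρ : Equiv.Perm n,
      ((ρ.sign : ℤ) : R) * ((τ.sign : ℤ) : R) * ∏ i, A (ρ i) (τ i) = A.det := fun τ => by
    have h1 : ((τ.sign : ℤ) : R) * ((τ.sign : ℤ) : R) = 1 := by
      rw [← Int.cast_mul, ← Units.val_mul, Int.units_mul_self]; simp
    calc _ = ((τ.sign : ℤ) : R) * (A.submatrix id τ).det := by
          rw [Matrix.det_apply', Finset.mul_sum]
          exact Finset.sum_congr rfl fun ρ _ => by simp only [Matrix.submatrix_apply, id]; ring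
      _ = _ := by rw [Matrix.det_permute', ← mul_assoc, h1, one_mul]
  simp [h, Fintype.card_perm]

/-- The integrand of a moment is an Euler-null function. -/
theorem eulerNull_laguerreDensity [DecidableEq ι] [Fintype ι] (hα : 0 ≤ α) {f f' : ι → ℝ → ℝ}
    (hf : ∀ j, EulerPair (f j) (f' j)) (S : Finset ι) :
    EulerNull fun x : Fin m → ℝ => laguerreDensity m α x * ∏ j ∈ S, linearStatistic (f j) x := by
  obtain ⟨c, hc, h⟩ := exists_det_laguerreQ hα m
  simp only [fun x => laguerreDensity_mul_prod_eq hc (h x) f S]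
  refine .const_mul _ (.sum _ fun ρ _ => .sum _ fun τ _ => .const_mul _ (.sum _ fun B _ =>
    .const_mul _ ?_))
  choose g hg using fun n => eulerPair_laguerreQ n α
  choose F hF using fun B : Finset ι => EulerPair.exists_prod B fun j _ => hf j
  exact .prod fun i => (((hF (B i)).mul (hg (ρ i))).mul (hg (τ i))).mul (.rpow hα)

/-- Andréief's identity. -/
theorem integral_laguerreDensity [DecidableEq ι] [Fintype ι] (hα : 0 ≤ α) {c : ℝ} (hc : c ≠ 0)
    (h : ∀ x : Fin m → ℝ, (Matrix.of fun a i : Fin m => laguerreQ a α (x i)).det =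
      c * ∏ i : Fin m, ∏ j ∈ Finset.Ioi i, (x j - x i)) {f : ι → ℝ → ℝ}
    (hf : ∀ j, Moderate (f j)) (S : Finset ι) :
    IntegrableOn (fun x => laguerreDensity m α x * ∏ j ∈ S, linearStatistic (f j) x)
      (orthant (Fin m)) ∧
    ∫ x in orthant (Fin m), laguerreDensity m α x * ∏ j ∈ S, linearStatistic (f j) x =
      (c ^ 2)⁻¹ * (m.factorial * (laguerreGram m α f).det S) := by
  simp only [fun x => laguerreDensity_mul_prod_eq hc (h x) f S]
  have hint : ∀ (B : Finset ι) (a b : ℕ), IntegrableOn (fun x => (∏ j ∈ B, f j x) *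
      laguerreQ a α x * laguerreQ b α x * x ^ α * Real.exp (-x)) (Set.Ioi 0) := fun B a b =>
    ((((Moderate.prod B fun j _ => hf j).mul (moderate_laguerreQ a α)).mul
      (moderate_laguerreQ b α)).mul (.rpow hα)).integrableOn
  have h1 : ∀ (ρ τ : Equiv.Perm (Fin m)) (B : Fin m → Finset ι),
      IntegrableOn (fun x : Fin m → ℝ => ∏ i, ((∏ j ∈ B i, f j (x i)) * laguerreQ (ρ i) α (x i) *
        laguerreQ (τ i) α (x i) * x i ^ α * Real.exp (-x i))) (orthant (Fin m)) := fun ρ τ B =>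
    integrableOn_orthant_prod fun i => hint (B i) (ρ i) (τ i)
  have h2 : ∀ (ρ τ : Equiv.Perm (Fin m)), IntegrableOn (fun x : Fin m → ℝ =>
      ∑ B : Fin m → Finset ι, (∏ i, SetFun.single (B i)) S *
        ∏ i, ((∏ j ∈ B i, f j (x i)) * laguerreQ (ρ i) α (x i) *
        laguerreQ (τ i) α (x i) * x i ^ α * Real.exp (-x i))) (orthant (Fin m)) := fun ρ τ =>
    integrable_finsetSum _ fun B _ => (h1 ρ τ B).const_mul _
  refine ⟨(integrable_finsetSum _ fun ρ _ => integrable_finsetSum _ fun τ _ =>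
    (h2 ρ τ).const_mul _).const_mul _, ?_⟩
  rw [integral_const_mul, integral_finsetSum _ fun ρ _ => integrable_finsetSum _ fun τ _ =>
    (h2 ρ τ).const_mul _]
  congr 1
  -- One determinant identity over the ring of set functions, read at the coefficient `S`, sums over
  -- all allotments at once.
  have hdet := congrArg (fun u : SetFun ι => u S) (sum_sign_mul_sign (laguerreGram m α f))
  have hL : ((Fintype.card (Fin m)).factorial * (laguerreGram m α f).det : SetFun ι) S =
      m.factorial * (laguerreGram m α f).det S := by
    rw [Fintype.card_fin, ← Int.cast_natCast, SetFun.intCast_mul_apply, Int.cast_natCast]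
  rw [← hL]
  refine Eq.trans ?_ hdet
  rw [SetFun.sum_apply]
  refine Finset.sum_congr rfl fun ρ _ => ?_
  rw [integral_finsetSum _ fun τ _ => (h2 ρ τ).const_mul _, SetFun.sum_apply]
  refine Finset.sum_congr rfl fun τ _ => ?_
  rw [integral_const_mul, integral_finsetSum _ fun B _ => (h1 ρ τ B).const_mul _,
    ← Int.cast_mul, ← Int.cast_mul, SetFun.intCast_mul_apply, SetFun.prod_apply]
  congr 1
  refine Finset.sum_congr rfl fun B _ => ?_
  rw [integral_const_mul]
  congr 1
  exact integral_orthant_prod fun i x => (∏ j ∈ B i, f j x) * laguerreQ (ρ i) α x *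
    laguerreQ (τ i) α x * x ^ α * Real.exp (-x)

theorem measurable_laguerreDensity (m : ℕ) (α : ℝ) : Measurable (laguerreDensity m α) := by
  unfold laguerreDensity
  fun_prop

theorem laguerreDensity_nonneg {x : Fin m → ℝ} (hx : x ∈ orthant (Fin m)) :
    0 ≤ laguerreDensity m α x := by
  unfold laguerreDensity
  have : ∀ i, 0 ≤ x i ^ α := fun i => Real.rpow_nonneg (hx i) α
  refine mul_nonneg (Finset.prod_nonneg fun i _ => Finset.prod_nonneg fun j _ => sq_nonneg _)
    (Finset.prod_nonneg fun i _ => mul_nonneg (this i) (Real.exp_pos _).le)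

theorem integral_laguerreDensity_pos (hα : 0 ≤ α) (m : ℕ) :
    0 < ∫ y in orthant (Fin m), laguerreDensity m α y := by
  obtain ⟨c, hc, h⟩ := exists_det_laguerreQ hα m
  have := (integral_laguerreDensity (ι := Empty) hα hc h (f := fun _ => id) (fun j => j.elim) ∅).2
  simp only [Finset.prod_empty, mul_one] at this
  rw [this, det_apply_empty (laguerreGram_empty hα _)]
  have := Nat.factorial_ne_zero m
  positivity

theorem integrable_wishartLaguerre_iff (hα : 0 ≤ α) (F : (Fin m → ℝ) → ℝ) :
    Integrable F (wishartLaguerre m α) ↔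
      IntegrableOn (fun x => laguerreDensity m α x * F x) (orthant (Fin m)) := by
  have hZ := integral_laguerreDensity_pos hα m
  have hmeas : Measurable fun x : Fin m → ℝ => ENNReal.ofReal
      (laguerreDensity m α x / ∫ y in orthant (Fin m), laguerreDensity m α y) :=
    ((measurable_laguerreDensity m α).div_const _).ennreal_ofReal
  rw [wishartLaguerre, integrable_withDensity_iff_integrable_smul' hmeas
    (Filter.Eventually.of_forall fun x => ENNReal.ofReal_lt_top), IntegrableOn,
    ← integrable_const_mul_iff (c := (∫ y in orthant (Fin m), laguerreDensity m α y)⁻¹)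
      (isUnit_iff_ne_zero.2 (inv_ne_zero hZ.ne')) (fun x => laguerreDensity m α x * F x)]
  refine integrable_congr ?_
  refine (ae_restrict_iff' measurableSet_orthant).2 (Filter.Eventually.of_forall fun x hx => ?_)
  simp only
  rw [ENNReal.toReal_ofReal (div_nonneg (laguerreDensity_nonneg hx) hZ.le), smul_eq_mul]
  ring

theorem integral_wishartLaguerre (hα : 0 ≤ α) (F : (Fin m → ℝ) → ℝ) :
    ∫ x, F x ∂(wishartLaguerre m α) =
      (∫ y in orthant (Fin m), laguerreDensity m α y)⁻¹ *
        ∫ x in orthant (Fin m), laguerreDensity m α x * F x := by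
  have hZ := integral_laguerreDensity_pos hα m
  have hmeas : Measurable fun x : Fin m → ℝ => ENNReal.ofReal
      (laguerreDensity m α x / ∫ y in orthant (Fin m), laguerreDensity m α y) :=
    ((measurable_laguerreDensity m α).div_const _).ennreal_ofReal
  rw [wishartLaguerre, integral_withDensity_eq_integral_toReal_smul hmeas
    (Filter.Eventually.of_forall fun x => ENNReal.ofReal_lt_top), ← integral_const_mul]
  refine setIntegral_congr_fun measurableSet_orthant fun x hx => ?_
  rw [ENNReal.toReal_ofReal (div_nonneg (laguerreDensity_nonneg hx) hZ.le), smul_eq_mul]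
  ring

/-- The joint moments of the linear statistics. -/
noncomputable def laguerreMoment (m : ℕ) (α : ℝ) (f : ι → ℝ → ℝ) (S : Finset ι) : ℝ :=
  ∫ x, ∏ j ∈ S, linearStatistic (f j) x ∂(wishartLaguerre m α)

theorem integrable_prod_linearStatistic [DecidableEq ι] [Fintype ι] (hα : 0 ≤ α) {f : ι → ℝ → ℝ}
    (hf : ∀ j, Moderate (f j)) (S : Finset ι) :
    Integrable (fun x => ∏ j ∈ S, linearStatistic (f j) x) (wishartLaguerre m α) := by
  obtain ⟨c, hc, h⟩ := exists_det_laguerreQ hα m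
  exact (integrable_wishartLaguerre_iff hα _).2 (integral_laguerreDensity hα hc h hf S).1

/-- The factor $m!/c^2$ is common to numerator and normalization, and the determinant at `∅` is $1$
by orthonormality. -/
theorem laguerreMoment_eq_det [DecidableEq ι] [Fintype ι] (hα : 0 ≤ α) {f : ι → ℝ → ℝ}
    (hf : ∀ j, Moderate (f j)) (S : Finset ι) :
    laguerreMoment m α f S = (laguerreGram m α f).det S := by
  obtain ⟨c, hc, h⟩ := exists_det_laguerreQ hα m
  have h0 := (integral_laguerreDensity hα hc h hf ∅).2
  simp only [Finset.prod_empty, mul_one] at h0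
  rw [laguerreMoment, integral_wishartLaguerre hα, (integral_laguerreDensity hα hc h hf S).2, h0,
    det_apply_empty (laguerreGram_empty hα _)]
  have := Nat.factorial_ne_zero m
  field_simp

theorem laguerreMoment_empty [DecidableEq ι] [Fintype ι] (hα : 0 ≤ α) {f : ι → ℝ → ℝ}
    (hf : ∀ j, Moderate (f j)) : laguerreMoment m α f ∅ = 1 := by
  rw [laguerreMoment_eq_det hα hf, det_apply_empty (laguerreGram_empty hα _)]

end Ensemble

/-! ### Dilating the joint density. -/

section Scaling

variable {m : ℕ} {α : ℝ} {ι : Type*}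

/-- Logarithmic derivatives add, in a form that also allows vanishing factors. -/
theorem hasDerivAt_prod_of_log {κ : Type*} (s : Finset κ) {F : κ → ℝ → ℝ} {c : κ → ℝ} {t : ℝ}
    (h : ∀ i ∈ s, HasDerivAt (F i) (c i * F i t) t) :
    HasDerivAt (fun θ => ∏ i ∈ s, F i θ) ((∑ i ∈ s, c i) * ∏ i ∈ s, F i t) t := by
  classical
  refine (HasDerivAt.fun_finsetProd h).congr_deriv ?_
  rw [Finset.sum_mul]
  refine Finset.sum_congr rfl fun i hi => ?_
  rw [← Finset.mul_prod_erase s _ hi, smul_eq_mul]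
  ring

theorem hasDerivAt_mul_const_one (y : ℝ) : HasDerivAt (fun θ : ℝ => θ * y) y 1 := by
  simpa using (hasDerivAt_id (1 : ℝ)).mul_const y

theorem EulerPair.hasDerivAt_scale {g g' : ℝ → ℝ} (h : EulerPair g g') {y : ℝ} (hy : 0 < y) :
    HasDerivAt (fun θ : ℝ => g (θ * y)) (g' y) 1 := by
  have h1 : HasDerivAt g (g' y / y) (1 * y) := by rw [one_mul]; exact h.hasDerivAt y hy
  refine (h1.comp 1 (hasDerivAt_mul_const_one y)).congr_deriv ?_
  field_simp

theorem hasDerivAt_weight_scale {α : ℝ} (hα : 0 ≤ α) {y : ℝ} (hy : 0 < y) :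
    HasDerivAt (fun θ : ℝ => (θ * y) ^ α * Real.exp (-(θ * y)))
      ((α - y) * ((1 * y) ^ α * Real.exp (-(1 * y)))) 1 := by
  refine (((EulerPair.rpow hα).hasDerivAt_scale hy).mul
    ((hasDerivAt_mul_const_one y).neg.exp)).congr_deriv ?_
  simp only [one_mul, Pi.neg_apply]
  ring

/-- The density is homogeneous up to the exponential factor. -/
theorem exists_hasDerivAt_laguerreDensity (m : ℕ) (hα : 0 ≤ α) : ∃ D : ℝ, ∀ x : Fin m → ℝ,
    (∀ i, 0 < x i) → HasDerivAt (fun θ : ℝ => laguerreDensity m α (θ • x))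
      ((D - ∑ i, x i) * laguerreDensity m α x) 1 := by
  -- The degree of homogeneity: $2$ for each squared difference and $\alpha$ for each eigenvalue.
  refine ⟨(∑ i : Fin m, ∑ _j ∈ Finset.Ioi i, 2) + m * α, fun x hx => ?_⟩
  have h1 : HasDerivAt (fun θ : ℝ => ∏ i : Fin m, ∏ j ∈ Finset.Ioi i, (θ * x i - θ * x j) ^ 2)
      ((∑ i : Fin m, ∑ _j ∈ Finset.Ioi i, 2) *
        ∏ i : Fin m, ∏ j ∈ Finset.Ioi i, (1 * x i - 1 * x j) ^ 2) 1 := by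
    refine hasDerivAt_prod_of_log _ fun i _ => hasDerivAt_prod_of_log _ fun j _ => ?_
    refine (((hasDerivAt_mul_const_one (x i)).fun_sub
      (hasDerivAt_mul_const_one (x j))).fun_pow 2).congr_deriv ?_
    ring
  have h2 := hasDerivAt_prod_of_log Finset.univ fun i _ => hasDerivAt_weight_scale hα (hx i)
  refine (h1.mul h2).congr_deriv ?_
  rw [laguerreDensity]
  simp only [one_mul, Finset.sum_sub_distrib, Finset.sum_const, Finset.card_univ,
    Fintype.card_fin, nsmul_eq_mul]
  ring

theorem hasDerivAt_linearStatistic {g g' : ℝ → ℝ} (h : EulerPair g g') {x : Fin m → ℝ}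
    (hx : ∀ i, 0 < x i) :
    HasDerivAt (fun θ : ℝ => linearStatistic g (θ • x)) (linearStatistic g' x) 1 :=
  HasDerivAt.fun_sum fun i _ => h.hasDerivAt_scale (hx i)

variable [DecidableEq ι]

theorem moderate_update {f f' : ι → ℝ → ℝ} (hf : ∀ j, EulerPair (f j) (f' j)) (u j : ι) :
    Moderate (Function.update f u (f' u) j) := by
  by_cases h : j = u
  · subst h; simpa using (hf j).moderate'
  · simpa [h] using (hf j).moderate

theorem laguerreMoment_update_of_notMem (f : ι → ℝ → ℝ) (u : ι) (g : ℝ → ℝ) {p : Finset ι}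
    (hu : u ∉ p) : laguerreMoment m α (Function.update f u g) p = laguerreMoment m α f p := by
  unfold laguerreMoment
  congr 1
  funext x
  refine Finset.prod_congr rfl fun j hj => ?_
  rw [Function.update_of_ne fun h => hu (by rw [← h]; exact hj)]

variable [Fintype ι]

/-- Inserting the trace statistic `∑ x_i` into a moment is, up to a constant, the Euler
derivation. -/
theorem laguerreMoment_insert (hα : 0 ≤ α) {f f' : ι → ℝ → ℝ}
    (hf : ∀ j, EulerPair (f j) (f' j)) {s : ι} (hs : ∀ x, 0 < x → f s x = x) {S : Finset ι}
    (hS : s ∉ S) :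
    laguerreMoment m α f (insert s S) = laguerreMoment m α f {s} * laguerreMoment m α f S +
      ∑ u ∈ S, laguerreMoment m α (Function.update f u (f' u)) S := by
  obtain ⟨D, hD⟩ := exists_hasDerivAt_laguerreDensity m hα
  -- Dilation of $e^{-\sum x_i}$ produces the trace statistic; the extra $m$ is the divergence of
  -- the dilation field on $\mathbb{R}^m$.
  have key : ∀ S : Finset ι, s ∉ S → laguerreMoment m α f (insert s S) =
      (D + m) * laguerreMoment m α f S +
        ∑ u ∈ S, laguerreMoment m α (Function.update f u (f' u)) S := by
    intro S hS
    have hder : ∀ x : Fin m → ℝ, (∀ i, 0 < x i) → HasDerivAt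
        (fun θ : ℝ => laguerreDensity m α (θ • x) * ∏ j ∈ S, linearStatistic (f j) (θ • x))
        (D * (laguerreDensity m α x * ∏ j ∈ S, linearStatistic (f j) x) -
          laguerreDensity m α x * ∏ j ∈ insert s S, linearStatistic (f j) x +
          ∑ u ∈ S, laguerreDensity m α x *
            ∏ j ∈ S, linearStatistic (Function.update f u (f' u) j) x) 1 := by
      intro x hx
      have h1 := HasDerivAt.fun_finsetProd (u := S) (x := (1 : ℝ))
        (f := fun j (θ : ℝ) => linearStatistic (f j) (θ • x))
        fun j _ => hasDerivAt_linearStatistic (hf j) hx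
      refine ((hD x hx).mul h1).congr_deriv ?_
      have h2 : linearStatistic (f s) x = ∑ i, x i :=
        Finset.sum_congr rfl fun i _ => hs _ (hx i)
      rw [Finset.prod_insert hS, h2, ← Finset.mul_sum]
      simp only [one_smul, smul_eq_mul]
      have h3 : ∀ u ∈ S, ∏ j ∈ S, linearStatistic (Function.update f u (f' u) j) x =
          (∏ j ∈ S.erase u, linearStatistic (f j) x) * linearStatistic (f' u) x := by
        intro u hu
        rw [← Finset.prod_erase_mul _ _ hu, Function.update_self]
        congr 1
        refine Finset.prod_congr rfl fun j hj => ?_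
        rw [Function.update_of_ne (Finset.ne_of_mem_erase hj)]
      rw [Finset.sum_congr rfl h3]
      ring
    have hint := (eulerNull_laguerreDensity hα hf S).integral_eq hder
    have hI : ∀ {g : ι → ℝ → ℝ}, (∀ j, Moderate (g j)) → ∀ S : Finset ι, IntegrableOn
        (fun x => laguerreDensity m α x * ∏ j ∈ S, linearStatistic (g j) x) (orthant (Fin m)) :=
      fun hg S => (integrable_wishartLaguerre_iff hα _).1 (integrable_prod_linearStatistic hα hg S)
    have hf0 : ∀ j, Moderate (f j) := fun j => (hf j).moderate
    have hint2 := hint.2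
    have hsub : IntegrableOn (fun x => D * (laguerreDensity m α x *
        ∏ j ∈ S, linearStatistic (f j) x) - laguerreDensity m α x *
        ∏ j ∈ insert s S, linearStatistic (f j) x) (orthant (Fin m)) :=
      ((hI hf0 S).const_mul D).sub (hI hf0 _)
    rw [integral_add hsub
      (integrable_finsetSum _ fun u _ => hI (moderate_update hf u) S),
      integral_sub ((hI hf0 S).const_mul D) (hI hf0 _), integral_const_mul,
      integral_finsetSum _ fun u _ => hI (moderate_update hf u) S, Fintype.card_fin] at hint2
    simp only [laguerreMoment, integral_wishartLaguerre hα]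
    rw [← Finset.mul_sum]
    linear_combination (-(∫ y in orthant (Fin m), laguerreDensity m α y)⁻¹) * hint2
  -- The empty case identifies $D+m$ as the mean of the trace.
  have h0 := key ∅ (by simp)
  rw [laguerreMoment_empty hα fun j => (hf j).moderate] at h0
  simp only [Finset.sum_empty, mul_one, add_zero, insert_empty_eq] at h0
  rw [h0, key S hS]

/-- The cumulants with the trace statistic in one slot. -/
theorem cumulantOf_laguerreMoment_insert (hα : 0 ≤ α) {f f' : ι → ℝ → ℝ}
    (hf : ∀ j, EulerPair (f j) (f' j)) {s : ι} (hs : ∀ x, 0 < x → f s x = x) {S : Finset ι}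
    (hS : s ∉ S) (hne : S.Nonempty) :
    cumulantOf (laguerreMoment m α f) (insert s S) =
      ∑ u ∈ S, cumulantOf (laguerreMoment m α (Function.update f u (f' u))) S :=
  cumulantOf_insert (laguerreMoment_empty hα fun j => (hf j).moderate)
    (V := fun u => laguerreMoment m α (Function.update f u (f' u)))
    (fun u _ hu => laguerreMoment_update_of_notMem f u (f' u) hu)
    (fun _ hp => laguerreMoment_insert hα hf hs hp) hS hne

end Scaling

/-! ### Cyclic products of kernels and their dilation. -/

section Kernels

variable {m : ℕ} {α : ℝ} {β : Type*} [Fintype β]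

theorem laguerreWeight_pos (α : ℝ) {x : ℝ} (hx : 0 < x) : 0 < laguerreWeight α x :=
  mul_pos (Real.rpow_pos_of_pos hx α) (Real.exp_pos _)

/-- Each variable occurs once as a first and once as a second argument, so the square roots pair up.
-/
theorem prod_sqrt_laguerreWeight (σ : Equiv.Perm β) {x : β → ℝ} (hx : ∀ p, 0 < x p) :
    ∏ p, Real.sqrt (laguerreWeight α (x p) * laguerreWeight α (x (σ p))) =
      ∏ p, laguerreWeight α (x p) := by
  have h : ∀ p, Real.sqrt (laguerreWeight α (x p) * laguerreWeight α (x (σ p))) =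
      Real.sqrt (laguerreWeight α (x p)) * Real.sqrt (laguerreWeight α (x (σ p))) := fun p =>
    Real.sqrt_mul (laguerreWeight_pos α (hx p)).le _
  simp only [h]
  rw [Finset.prod_mul_distrib, Equiv.prod_comp σ fun p => Real.sqrt (laguerreWeight α (x p)),
    ← Finset.prod_mul_distrib]
  exact Finset.prod_congr rfl fun p _ => Real.mul_self_sqrt (laguerreWeight_pos α (hx p)).le

/-- Expansion of a cyclic product of kernels of finite rank into products of functions of one
variable. -/
theorem prod_kernel_eq [DecidableEq β] {κ : Type*} (σ : Equiv.Perm β) (g : β → ℝ → ℝ)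
    (T : β → Finset κ) (U V : β → κ → ℝ → ℝ) {x : β → ℝ} (hx : ∀ p, 0 < x p) :
    (∏ p, g p (x p)) * ∏ p, (Real.sqrt (laguerreWeight α (x p) * laguerreWeight α (x (σ p))) *
        ∑ a ∈ T p, U p a (x p) * V p a (x (σ p))) =
      ∑ a ∈ Fintype.piFinset T, ∏ p, (g p (x p) * U p (a p) (x p) *
        V (σ.symm p) (a (σ.symm p)) (x p) * x p ^ α * Real.exp (-x p)) := by
  rw [Finset.prod_mul_distrib, prod_sqrt_laguerreWeight σ hx, Finset.prod_univ_sum,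
    Finset.mul_sum, Finset.mul_sum]
  refine Finset.sum_congr rfl fun a _ => ?_
  have h : ∏ p, V p (a p) (x (σ p)) = ∏ p, V (σ.symm p) (a (σ.symm p)) (x p) := by
    rw [← Equiv.prod_comp σ fun p => V (σ.symm p) (a (σ.symm p)) (x p)]
    simp
  simp only [Finset.prod_mul_distrib, h, laguerreWeight]
  ring

theorem integrableOn_prod_kernel [DecidableEq β] {κ : Type*} (hα : 0 ≤ α) (σ : Equiv.Perm β)
    {g : β → ℝ → ℝ} (hg : ∀ p, Moderate (g p)) (T : β → Finset κ) {U V : β → κ → ℝ → ℝ}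
    (hU : ∀ p a, Moderate (U p a)) (hV : ∀ p a, Moderate (V p a)) :
    IntegrableOn (fun x : β → ℝ => (∏ p, g p (x p)) *
      ∏ p, (Real.sqrt (laguerreWeight α (x p) * laguerreWeight α (x (σ p))) *
        ∑ a ∈ T p, U p a (x p) * V p a (x (σ p)))) (orthant β) := by
  have h : IntegrableOn (fun x : β → ℝ => ∑ a ∈ Fintype.piFinset T, ∏ p, (g p (x p) *
      U p (a p) (x p) * V (σ.symm p) (a (σ.symm p)) (x p) * x p ^ α * Real.exp (-x p)))
      (orthant β) :=
    integrable_finsetSum _ fun a _ => integrableOn_orthant_prod fun p =>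
      ((((hg p).mul (hU p (a p))).mul (hV (σ.symm p) (a (σ.symm p)))).mul (.rpow hα)).integrableOn
  refine h.congr ?_
  filter_upwards [ae_pos_orthant] with x hx using (prod_kernel_eq σ g T U V hx).symm

theorem laguerreKernel_eq (hα : 0 ≤ α) (m : ℕ) (x y : ℝ) : laguerreKernel m α x y =
    Real.sqrt (laguerreWeight α x * laguerreWeight α y) *
      ∑ a : Fin m, laguerreQ a α x * laguerreQ a α y := by
  rw [laguerreKernel, Finset.sum_range]
  congr 1
  refine Finset.sum_congr rfl fun a _ => ?_
  rw [laguerreQ, laguerreQ, mul_mul_mul_comm, Real.mul_self_sqrt (laguerreNorm_pos hα a).le]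

/-- The cyclic products of correlation kernels are Euler-null functions. -/
theorem eulerNull_prod_laguerreKernel [DecidableEq β] (hα : 0 ≤ α) (m : ℕ) (σ : Equiv.Perm β)
    {g g' : β → ℝ → ℝ} (hg : ∀ p, EulerPair (g p) (g' p)) :
    EulerNull fun x : β → ℝ => (∏ p, g p (x p)) * ∏ p, laguerreKernel m α (x p) (x (σ p)) := by
  choose Q hQ using fun n => eulerPair_laguerreQ n α
  have h : EulerNull fun x : β → ℝ => ∑ a ∈ Fintype.piFinset fun _ : β => (Finset.univ :
      Finset (Fin m)), ∏ p, (g p (x p) * laguerreQ (a p) α (x p) *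
        laguerreQ (a (σ.symm p)) α (x p) * x p ^ α * Real.exp (-x p)) :=
    .sum _ fun a _ => .prod fun p =>
      (((hg p).mul (hQ (a p))).mul (hQ (a (σ.symm p)))).mul (.rpow hα)
  refine h.congr fun x hx => ?_
  simp only [laguerreKernel_eq hα]
  exact prod_kernel_eq σ g (fun _ => Finset.univ) (fun _ (a : Fin m) => laguerreQ a α)
    (fun _ a => laguerreQ a α) hx

theorem integrableOn_prod_laguerreKernel [DecidableEq β] (hα : 0 ≤ α) (m : ℕ) (σ : Equiv.Perm β)
    {g : β → ℝ → ℝ} (hg : ∀ p, Moderate (g p)) :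
    IntegrableOn (fun x : β → ℝ => (∏ p, g p (x p)) *
      ∏ p, laguerreKernel m α (x p) (x (σ p))) (orthant β) := by
  simp only [laguerreKernel_eq hα]
  exact integrableOn_prod_kernel hα σ hg (fun _ => Finset.univ)
    (U := fun _ (a : Fin m) => laguerreQ a α) (V := fun _ a => laguerreQ a α)
    (fun _ a => moderate_laguerreQ a α) (fun _ a => moderate_laguerreQ a α)

theorem integral_prod_laguerreKernel [DecidableEq β] (hα : 0 ≤ α) (m : ℕ) (σ : Equiv.Perm β)
    {g : β → ℝ → ℝ} (hg : ∀ p, Moderate (g p)) :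
    ∫ x in orthant β, (∏ p, g p (x p)) * ∏ p, laguerreKernel m α (x p) (x (σ p)) =
      ∑ a : β → Fin m, ∏ p, ∫ x in Set.Ioi (0 : ℝ), g p x * laguerreQ (a p) α x *
        laguerreQ (a (σ p)) α x * x ^ α * Real.exp (-x) := by
  have h : ∀ᵐ x ∂(volume : Measure (β → ℝ)).restrict (orthant β),
      (∏ p, g p (x p)) * ∏ p, laguerreKernel m α (x p) (x (σ p)) =
        ∑ a : β → Fin m, ∏ p, (g p (x p) * laguerreQ (a p) α (x p) *
          laguerreQ (a (σ p)) α (x p) * x p ^ α * Real.exp (-x p)) := by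
    filter_upwards [ae_pos_orthant] with x hx
    simp only [laguerreKernel_eq hα]
    rw [prod_kernel_eq σ g (fun _ => Finset.univ) (fun _ (a : Fin m) => laguerreQ a α)
      (fun _ a => laguerreQ a α) hx, Fintype.piFinset_univ,
      ← (σ.arrowCongr (Equiv.refl (Fin m))).symm.sum_comp]
    refine Finset.sum_congr rfl fun a _ => Finset.prod_congr rfl fun p _ => ?_
    simp only [Equiv.arrowCongr_symm, Equiv.arrowCongr_apply, Equiv.symm_symm, Equiv.refl_symm,
      Equiv.coe_refl, Function.comp_apply, id, Equiv.apply_symm_apply]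
    ring
  rw [integral_congr_ae h, integral_finsetSum]
  · exact Finset.sum_congr rfl fun a _ => integral_orthant_prod fun p x =>
      g p x * laguerreQ (a p) α x * laguerreQ (a (σ p)) α x * x ^ α * Real.exp (-x)
  · exact fun a _ => integrableOn_orthant_prod fun p =>
      ((((hg p).mul (moderate_laguerreQ _ _)).mul (moderate_laguerreQ _ _)).mul
        (.rpow hα)).integrableOn

/-- The weights contribute $\alpha-(x+y)/2$, one less than the factor in `euler_christoffelDarboux`;
the missing $1$ is the term $-K$, and the right-hand side there is $-L_D$ up to the weights. -/
theorem hasDerivAt_laguerreKernel (hα : 0 ≤ α) (hm : 1 ≤ m) {x y : ℝ} (hx : 0 < x) (hy : 0 < y) :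
    HasDerivAt (fun θ : ℝ => laguerreKernel m α (θ * x) (θ * y))
      (-decoupledKernel m α x y - laguerreKernel m α x y) 1 := by
  have hw : HasDerivAt (fun θ : ℝ => laguerreWeight α (θ * x) * laguerreWeight α (θ * y))
      ((2 * α - x - y) * (laguerreWeight α x * laguerreWeight α y)) 1 := by
    refine ((hasDerivAt_weight_scale hα hx).mul (hasDerivAt_weight_scale hα hy)).congr_deriv ?_
    simp only [one_mul, laguerreWeight]
    ring
  have hpos := mul_pos (laguerreWeight_pos α hx) (laguerreWeight_pos α hy)
  have hs := hw.sqrt (by simpa using hpos.ne')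
  have hk : HasDerivAt (fun θ : ℝ => ∑ n ∈ Finset.range m, (n.factorial : ℝ) /
      Real.Gamma (n + α + 1) * (laguerreL n α (θ * x) * laguerreL n α (θ * y)))
      (∑ n ∈ Finset.range m, (n.factorial : ℝ) / Real.Gamma (n + α + 1) *
        (laguerreE n α x * laguerreL n α y + laguerreL n α x * laguerreE n α y)) 1 := by
    refine HasDerivAt.fun_sum fun n _ => ?_
    refine ((((eulerPair_laguerreL n α).hasDerivAt_scale hx).mul
      ((eulerPair_laguerreL n α).hasDerivAt_scale hy)).const_mul _).congr_deriv ?_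
    simp only [one_mul]
  refine (hs.mul hk).congr_deriv ?_
  have key := euler_christoffelDarboux hα hm x y
  have hss : (2 * α - x - y) * (laguerreWeight α x * laguerreWeight α y) /
      (2 * Real.sqrt (laguerreWeight α x * laguerreWeight α y)) =
      (α - (x + y) / 2) * Real.sqrt (laguerreWeight α x * laguerreWeight α y) := by
    have h1 := Real.mul_self_sqrt hpos.le
    have h2 := (Real.sqrt_pos.2 hpos).ne'
    field_simp
    rw [pow_two, h1]
    ring
  simp only [one_mul]
  rw [hss, decoupledKernel, laguerreKernel]
  linear_combination Real.sqrt (laguerreWeight α x * laguerreWeight α y) * key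

end Kernels

/-! ### The decoupled integral as the Euler derivative of a cumulant. -/

section Decoupled

variable {m : ℕ} {α : ℝ} {l : ℕ}

/-- Each index lies in exactly one block. Written over the indices, the product can be
differentiated one statistic at a time. -/
theorem prod_parts_eq {ι : Type*} [Fintype ι] [DecidableEq ι]
    (P : Finpartition (Finset.univ : Finset ι)) (f : ι → ℝ → ℝ) (x : P.parts → ℝ) :
    ∏ p : P.parts, ∏ s ∈ p.1, f s (x p) = ∏ s, f s (x (P.baseBlock s)) := by
  rw [← Finset.prod_fiberwise Finset.univ P.baseBlock]
  refine Finset.prod_congr rfl fun p _ => ?_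
  refine Finset.prod_congr ?_ ?_
  · ext s
    simp only [Finset.mem_filter, Finset.mem_univ, true_and]
    rw [Finpartition.baseBlock, Subtype.ext_iff]
    exact (P.part_eq_iff_mem p.2).symm
  · intro s hs
    rw [(Finset.mem_filter.1 hs).2]

theorem integrableOn_decoupledIntegrand (hα : 0 ≤ α) {f : Fin l → ℝ → ℝ}
    (hf : ∀ j, Moderate (f j)) (P : Finpartition (Finset.univ : Finset (Fin l)))
    (σ : Equiv.Perm P.parts) (v : P.parts) :
    IntegrableOn (decoupledIntegrand m α f P σ v) (orthant P.parts) := by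
  -- The decoupled kernel has rank two: in the slot `v` the summation indices $0$ and $1$ label its
  -- two products, with the constant put on the first argument.
  set c : ℝ := -((m.factorial : ℝ) / (2 * Real.Gamma (m + α))) with hc
  have h := integrableOn_prod_kernel hα σ (g := fun p x => ∏ s ∈ p.1, f s x)
    (fun p => Moderate.prod _ fun s _ => hf s)
    (fun p => if p = v then {0, 1} else Finset.range m)
    (U := fun p a => if p = v then fun x => c * laguerreL (if a = 0 then m else m - 1) α x
      else laguerreQ a α)
    (V := fun p a => if p = v then laguerreL (if a = 0 then m - 1 else m) α else laguerreQ a α)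
    (fun p a => by
      split_ifs
      · exact (Moderate.const c).mul (eulerPair_laguerreL _ α).moderate
      · exact (Moderate.const c).mul (eulerPair_laguerreL _ α).moderate
      · exact moderate_laguerreQ a α)
    (fun p a => by
      split_ifs
      · exact (eulerPair_laguerreL _ α).moderate
      · exact (eulerPair_laguerreL _ α).moderate
      · exact moderate_laguerreQ a α)
  refine h.congr (Filter.Eventually.of_forall fun x => ?_)
  simp only [decoupledIntegrand]
  rw [mul_comm (decoupledKernel m α (x v) (x (σ v))), mul_assoc]
  congr 1
  rw [← Finset.mul_prod_erase _ _ (Finset.mem_univ v)]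
  congr 1
  · simp only [if_true, decoupledKernel, hc]
    rw [Finset.sum_pair zero_ne_one]
    simp only [if_true, one_ne_zero, if_false]
    ring
  · refine Finset.prod_congr rfl fun p hp => ?_
    simp only [Finset.ne_of_mem_erase hp, if_false]
    rw [laguerreKernel_eq hα, Finset.sum_range]

/-- Integration by parts: the decoupled kernels move the Euler derivative onto the statistics. -/
theorem sum_integral_decoupledIntegrand (hα : 0 ≤ α) (hm : 1 ≤ m) {f f' : Fin l → ℝ → ℝ}
    (hf : ∀ j, EulerPair (f j) (f' j)) (P : Finpartition (Finset.univ : Finset (Fin l)))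
    (σ : Equiv.Perm P.parts) :
    ∑ v : P.parts, ∫ x in orthant P.parts, decoupledIntegrand m α f P σ v x =
      ∑ u : Fin l, ∫ x in orthant P.parts,
        (∏ p : P.parts, ∏ s ∈ p.1, Function.update f u (f' u) s (x p)) *
          ∏ p : P.parts, laguerreKernel m α (x p) (x (σ p)) := by
  choose F hF using fun p : P.parts => EulerPair.exists_prod p.1 fun j _ => hf j
  have hder : ∀ x : P.parts → ℝ, (∀ p, 0 < x p) → HasDerivAt
      (fun θ : ℝ => (∏ p : P.parts, ∏ s ∈ p.1, f s ((θ • x) p)) *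
        ∏ p : P.parts, laguerreKernel m α ((θ • x) p) ((θ • x) (σ p)))
      (∑ u : Fin l, (∏ p : P.parts, ∏ s ∈ p.1, Function.update f u (f' u) s (x p)) *
          (∏ p : P.parts, laguerreKernel m α (x p) (x (σ p))) -
        (∑ v : P.parts, decoupledIntegrand m α f P σ v x +
          Fintype.card P.parts * ((∏ p : P.parts, ∏ s ∈ p.1, f s (x p)) *
            ∏ p : P.parts, laguerreKernel m α (x p) (x (σ p))))) 1 := by
    intro x hx
    have h1 : HasDerivAt (fun θ : ℝ => ∏ p : P.parts, ∏ s ∈ p.1, f s ((θ • x) p))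
        (∑ u : Fin l, ∏ p : P.parts, ∏ s ∈ p.1, Function.update f u (f' u) s (x p)) 1 := by
      simp only [prod_parts_eq]
      have := HasDerivAt.fun_finsetProd (u := Finset.univ) (x := (1 : ℝ))
        (f := fun s (θ : ℝ) => f s (θ * x (P.baseBlock s)))
        fun s _ => (hf s).hasDerivAt_scale (hx (P.baseBlock s))
      refine this.congr_deriv ?_
      refine Finset.sum_congr rfl fun u _ => ?_
      rw [← Finset.prod_erase_mul _ _ (Finset.mem_univ u), Function.update_self, smul_eq_mul]
      congr 1
      refine Finset.prod_congr rfl fun j hj => ?_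
      rw [Function.update_of_ne (Finset.ne_of_mem_erase hj), one_mul]
    have h2 := HasDerivAt.fun_finsetProd (u := Finset.univ) (x := (1 : ℝ))
      (f := fun (p : P.parts) (θ : ℝ) => laguerreKernel m α (θ * x p) (θ * x (σ p)))
      fun p _ => hasDerivAt_laguerreKernel hα hm (hx p) (hx (σ p))
    refine (h1.mul h2).congr_deriv ?_
    simp only [one_mul, one_smul, smul_eq_mul]
    rw [← Finset.sum_mul, sub_eq_add_neg]
    congr 1
    have h3 : ∀ v : P.parts, (∏ p ∈ Finset.univ.erase v, laguerreKernel m α (x p) (x (σ p))) *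
        (-decoupledKernel m α (x v) (x (σ v)) - laguerreKernel m α (x v) (x (σ v))) =
        -(decoupledKernel m α (x v) (x (σ v)) *
          ∏ p ∈ Finset.univ.erase v, laguerreKernel m α (x p) (x (σ p))) -
        ∏ p : P.parts, laguerreKernel m α (x p) (x (σ p)) := fun v => by
      rw [← Finset.mul_prod_erase Finset.univ _ (Finset.mem_univ v)]
      ring
    simp only [h3, Finset.sum_sub_distrib, Finset.sum_const, Finset.card_univ, nsmul_eq_mul,
      Finset.sum_neg_distrib, decoupledIntegrand]
    have h4 : ∀ v : P.parts, decoupledKernel m α (x v) (x (σ v)) *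
        (∏ p : P.parts, ∏ s ∈ p.1, f s (x p)) *
          ∏ p ∈ Finset.univ.erase v, laguerreKernel m α (x p) (x (σ p)) =
        (∏ p : P.parts, ∏ s ∈ p.1, f s (x p)) * (decoupledKernel m α (x v) (x (σ v)) *
          ∏ p ∈ Finset.univ.erase v, laguerreKernel m α (x p) (x (σ p))) := fun v => by ring
    simp only [h4]
    rw [← Finset.mul_sum]
    ring
  have hnull := eulerNull_prod_laguerreKernel hα m σ hF
  -- Each of the factors $K$ contributes one term $-K$; there are as many as blocks, so together
  -- they cancel the divergence term $-|P|\int G$.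
  have hint := (hnull.integral_eq hder).2
  have hi1 : ∀ u : Fin l, IntegrableOn (fun x : P.parts → ℝ =>
      (∏ p : P.parts, ∏ s ∈ p.1, Function.update f u (f' u) s (x p)) *
        ∏ p : P.parts, laguerreKernel m α (x p) (x (σ p))) (orthant P.parts) := fun u =>
    integrableOn_prod_laguerreKernel hα m σ (g := fun p x =>
      ∏ s ∈ p.1, Function.update f u (f' u) s x)
      fun p => Moderate.prod _ fun s _ => moderate_update hf u s
  have hi2 : ∀ v : P.parts, IntegrableOn (decoupledIntegrand m α f P σ v) (orthant P.parts) :=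
    integrableOn_decoupledIntegrand hα (fun j => (hf j).moderate) P σ
  have hi3 : IntegrableOn (fun x : P.parts → ℝ => ∑ v : P.parts, decoupledIntegrand m α f P σ v x +
      Fintype.card P.parts * ((∏ p : P.parts, ∏ s ∈ p.1, f s (x p)) *
        ∏ p : P.parts, laguerreKernel m α (x p) (x (σ p)))) (orthant P.parts) :=
    (integrable_finsetSum _ fun v _ => hi2 v).add (hnull.integrableOn.const_mul _)
  rw [integral_sub (integrable_finsetSum _ fun u _ => hi1 u) hi3, integral_add (integrable_finsetSum _ fun v _ => hi2 v) (hnull.integrableOn.const_mul _),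
    integral_finsetSum _ fun u _ => hi1 u, integral_finsetSum _ fun v _ => hi2 v,
    integral_const_mul] at hint
  linear_combination -hint

theorem kappa_eq_cumulantOf (m : ℕ) (α : ℝ) (f : Fin l → ℝ → ℝ) :
    kappa m α f = cumulantOf (laguerreMoment m α f) Finset.univ := rfl

open scoped Classical in
/-- The cumulants of linear statistics of a determinantal ensemble. -/
theorem kappa_eq_sum_cyclic (hα : 0 ≤ α) (hl : 1 ≤ l) {f : Fin l → ℝ → ℝ}
    (hf : ∀ j, Moderate (f j)) :
    kappa m α f = ∑ P : Finpartition (Finset.univ : Finset (Fin l)), (-1) ^ (P.parts.card - 1) *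
      ∑ σ ∈ Finset.univ.filter fun σ : Equiv.Perm P.parts => σ.IsCycleOn Set.univ,
        ∫ x in orthant P.parts, (∏ p : P.parts, ∏ s ∈ p.1, f s (x p)) *
          ∏ p : P.parts, laguerreKernel m α (x p) (x (σ p)) := by
  have : Nonempty (Fin l) := ⟨⟨0, hl⟩⟩
  rw [kappa_eq_cumulantOf, cumulantOf_congr fun p _ => laguerreMoment_eq_det hα hf p]
  refine (cumulantOf_det_univ (laguerreGram m α f) (laguerreGram_empty hα f)).trans ?_
  refine Finset.sum_congr rfl fun P _ => ?_
  congr 1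
  refine Finset.sum_congr rfl fun σ _ => ?_
  exact (integral_prod_laguerreKernel hα m σ (g := fun p x => ∏ s ∈ p.1, f s x)
    fun p => Moderate.prod _ fun s _ => hf s).symm

/-- The decoupled integral is the Euler derivative of the cumulant. -/
theorem decoupledIntegral_eq_sum_kappa (hα : 0 ≤ α) (hm : 1 ≤ m) (hl : 1 ≤ l)
    {f f' : Fin l → ℝ → ℝ} (hf : ∀ j, EulerPair (f j) (f' j)) :
    decoupledIntegral m α f = ∑ u : Fin l, kappa m α (Function.update f u (f' u)) := by
  classical
  simp only [kappa_eq_sum_cyclic hα hl (moderate_update hf _)]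
  rw [decoupledIntegral, Finset.sum_comm]
  refine Finset.sum_congr rfl fun P _ => ?_
  rw [← Finset.mul_sum]
  congr 1
  exact (Finset.sum_congr rfl fun σ _ => sum_integral_decoupledIntegrand hα hm hf P σ).trans
    Finset.sum_comm

end Decoupled

/-! ### The recursion for the statistics $T_k$, $R_k$ and $T$. -/

section LinearStatistics

variable {m : ℕ} {α : ℝ} {l : ℕ}

theorem kappa_update_linear (hα : 0 ≤ α) {f : Fin l → ℝ → ℝ} (hf : ∀ j, Moderate (f j))
    (u : Fin l) {φ ψ : ℝ → ℝ} (hφ : Moderate φ) (hψ : Moderate ψ) (a b : ℝ) :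
    kappa m α (Function.update f u fun x => a * φ x + b * ψ x) =
      a * kappa m α (Function.update f u φ) + b * kappa m α (Function.update f u ψ) := by
  have hupd : ∀ {χ : ℝ → ℝ}, Moderate χ → ∀ j, Moderate (Function.update f u χ j) := by
    intro χ hχ j
    by_cases h : j = u
    · subst h; simpa using hχ
    · simpa [h] using hf j
  have hsum : Moderate fun x => a * φ x + b * ψ x :=
    ((Moderate.const a).mul hφ).add ((Moderate.const b).mul hψ)
  refine cumulantOf_linear
    (M := laguerreMoment m α (Function.update f u fun x => a * φ x + b * ψ x))
    (M₁ := laguerreMoment m α (Function.update f u φ))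
    (M₂ := laguerreMoment m α (Function.update f u ψ))
    (laguerreMoment_empty hα (hupd hsum)) (s := u) (fun p hp => ?_) (fun p hp => ?_)
    (fun p hp => ?_) (Finset.mem_univ u)
  · rw [laguerreMoment_update_of_notMem _ _ _ hp, laguerreMoment_update_of_notMem _ _ _ hp]
  · rw [laguerreMoment_update_of_notMem _ _ _ hp, laguerreMoment_update_of_notMem _ _ _ hp]
  · have hprod : ∀ (χ : ℝ → ℝ) (x : Fin m → ℝ),
        ∏ j ∈ p, linearStatistic (Function.update f u χ j) x =
          linearStatistic χ x * ∏ j ∈ p.erase u, linearStatistic (f j) x := by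
      intro χ x
      rw [← Finset.mul_prod_erase _ _ hp, Function.update_self]
      congr 1
      refine Finset.prod_congr rfl fun j hj => ?_
      rw [Function.update_of_ne (Finset.ne_of_mem_erase hj)]
    unfold laguerreMoment
    rw [← integral_const_mul, ← integral_const_mul,
      ← integral_add ((integrable_prod_linearStatistic hα (hupd hφ) p).const_mul a)
        ((integrable_prod_linearStatistic hα (hupd hψ) p).const_mul b)]
    congr 1
    funext x
    simp only [hprod]
    have : linearStatistic (fun x => a * φ x + b * ψ x) x =
        a * linearStatistic φ x + b * linearStatistic ψ x := by
      simp only [linearStatistic, Finset.sum_add_distrib, Finset.mul_sum]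
    rw [this]
    ring

/-- A trace statistic in one slot of a cumulant gives the decoupled integral of the others. -/
theorem kappa_update_trace (hα : 0 ≤ α) (hm : 1 ≤ m) (hl : 1 ≤ l) {f f' : Fin (l + 1) → ℝ → ℝ}
    (hf : ∀ j, EulerPair (f j) (f' j)) (s : Fin (l + 1)) :
    kappa m α (Function.update f s (fR 1)) =
      decoupledIntegral m α fun j => f (s.succAbove j) := by
  have : Nonempty (Fin l) := ⟨⟨0, hl⟩⟩
  set F := Function.update f s (fR 1) with hF
  set F' := Function.update f' s fun x => 1 * x ^ (1 : ℝ) with hF'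
  have hFF : ∀ j, EulerPair (F j) (F' j) := by
    intro j
    by_cases h : j = s
    · subst h
      rw [hF, hF', Function.update_self, Function.update_self]
      exact EulerPair.rpow zero_le_one
    · rw [hF, hF', Function.update_of_ne h, Function.update_of_ne h]
      exact hf j
  have hmap : Finset.univ.erase s = Finset.univ.map s.succAboveEmb := by
    ext j
    simp [Fin.exists_succAbove_eq_iff]
  -- Both sides are the sum of cumulants with one statistic replaced by its Euler derivative: the
  -- right from dilating the kernels, the left from dilating the density. Only relabelling by
  -- `s.succAboveEmb` remains.
  rw [decoupledIntegral_eq_sum_kappa hα hm hl fun j => hf (s.succAbove j), kappa_eq_cumulantOf,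
    ← Finset.insert_erase (Finset.mem_univ s),
    cumulantOf_laguerreMoment_insert hα hFF (s := s) (by simp [hF, fR])
      (Finset.notMem_erase s _) (by rw [hmap]; simp), hmap, Finset.sum_map]
  refine Finset.sum_congr rfl fun u _ => ?_
  have hmod := moderate_update hFF (s.succAboveEmb u)
  rw [← cumulantOf_map s.succAboveEmb (laguerreMoment_empty hα hmod) Finset.univ_nonempty,
    kappa_eq_cumulantOf]
  refine cumulantOf_congr fun p _ => ?_
  unfold laguerreMoment
  congr 1
  funext x
  rw [Finset.prod_map]
  refine Finset.prod_congr rfl fun j _ => ?_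
  congr 1
  have h1 : ∀ j, F (s.succAbove j) = f (s.succAbove j) := fun j => by
    rw [hF, Function.update_of_ne (Fin.succAbove_ne s j)]
  have h2 : ∀ j, F' (s.succAbove j) = f' (s.succAbove j) := fun j => by
    rw [hF', Function.update_of_ne (Fin.succAbove_ne s j)]
  simp only [Fin.coe_succAboveEmb, h2]
  by_cases h : j = u
  · subst h; simp
  · rw [Function.update_of_ne fun h' => h (Fin.succAbove_right_injective h'),
      Function.update_of_ne h, h1]

theorem eulerPair_fR {k : ℝ} (hk : 0 ≤ k) : EulerPair (fR k) fun x => k * fR k x :=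
  EulerPair.rpow hk

theorem eulerPair_fT {k : ℝ} (hk : 0 ≤ k) : EulerPair (fT k) fun x => k * fT k x + 1 * fR k x := by
  have h := (EulerPair.rpow hk).mul EulerPair.log
  have e : (fun x => k * fT k x + 1 * fR k x) =
      fun x => k * x ^ k * Real.log x + x ^ k * 1 := by
    funext x; simp only [fT, fR]; ring
  rw [e]
  exact h

theorem eulerPair_withT {g g' : ℝ → ℝ} (hg : EulerPair g g') (j : Fin l) :
    EulerPair (withT l g j) (if j.val = 0 then g' else fun x => 1 * fT 1 x + 1 * fR 1 x) := by
  unfold withT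
  split_ifs
  · exact hg
  · exact eulerPair_fT zero_le_one

theorem allIntegrable_withT (hα : 0 ≤ α) {g g' : ℝ → ℝ} (hg : EulerPair g g') :
    AllIntegrable m α (withT l g) :=
  ⟨fun p => integrable_prod_linearStatistic hα (fun j => (eulerPair_withT hg j).moderate) p,
    fun P σ v _ =>
      integrableOn_decoupledIntegrand hα (fun j => (eulerPair_withT hg j).moderate) P σ v⟩

theorem update_withT_zero (g h : ℝ → ℝ) :
    Function.update (withT (l + 1) g) 0 h = withT (l + 1) h := by
  funext j
  by_cases hj : j = 0
  · subst hj; simp [withT]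
  · have : j.val ≠ 0 := fun h => hj (Fin.ext h)
    rw [Function.update_of_ne hj]
    simp [withT, this]

/-- The omitted slot `i.succ` is never the first, so the distinguished statistic keeps its place. -/
theorem withT_succAbove (g : ℝ → ℝ) (i j : Fin l) :
    withT (l + 1) g (i.succ.succAbove j) = withT l g j := by
  have : (i.succ.succAbove j).val = 0 ↔ j.val = 0 := by
    simp only [Fin.succAbove, Fin.lt_def]
    split_ifs with h
    · simp
    · simp at h ⊢
      omega
  simp only [withT, this]

/-- The recursion for the decoupled integrals. -/
theorem decoupledIntegral_withT_succ (hα : 0 ≤ α) (hm : 1 ≤ m) {g g' : ℝ → ℝ}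
    (hg : EulerPair g g') : decoupledIntegral m α (withT (l + 1) g) =
      kappa m α (withT (l + 1) g') +
        l * (kappa m α (withT (l + 1) g) + decoupledIntegral m α (withT l g)) := by
  have hf := eulerPair_withT (l := l + 1) hg
  rw [decoupledIntegral_eq_sum_kappa hα hm (Nat.succ_pos l) hf, Fin.sum_univ_succ]
  simp only [Fin.val_zero, if_true, update_withT_zero, Fin.val_succ, Nat.succ_ne_zero, if_false]
  congr 1
  -- $E(x\ln x)=x\ln x+x$: the first term restores $T$ in the slot, the second puts the trace there,
  -- which `kappa_update_trace` turns into the decoupled integral one order lower.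
  have h : ∀ i : Fin l,
      kappa m α (Function.update (withT (l + 1) g) i.succ fun x => 1 * fT 1 x + 1 * fR 1 x) =
        kappa m α (withT (l + 1) g) + decoupledIntegral m α (withT l g) := by
    intro i
    have h1 : Function.update (withT (l + 1) g) i.succ (fT 1) = withT (l + 1) g := by
      rw [Function.update_eq_self_iff]
      simp [withT]
    rw [kappa_update_linear hα (fun j => (hf j).moderate) i.succ
      (eulerPair_fT zero_le_one).moderate (eulerPair_fR zero_le_one).moderate, h1,
      kappa_update_trace hα hm (Fin.pos i) hf]
    simp only [withT_succAbove, one_mul]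
  rw [Finset.sum_congr rfl fun i _ => h i, Finset.sum_const, Finset.card_univ, Fintype.card_fin,
    nsmul_eq_mul]

theorem kappa_withT_linear (hα : 0 ≤ α) {φ ψ : ℝ → ℝ} (hφ : Moderate φ) (hψ : Moderate ψ)
    (a b : ℝ) : kappa m α (withT (l + 1) fun x => a * φ x + b * ψ x) =
      a * kappa m α (withT (l + 1) φ) + b * kappa m α (withT (l + 1) ψ) := by
  have := kappa_update_linear (m := m) hα
    (fun j => (eulerPair_withT (l := l + 1) (eulerPair_fR zero_le_one) j).moderate) 0 hφ hψ a b
  simpa only [update_withT_zero] using this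

/-- The recursion is unrolled down to `D 1`; `D 0` is multiplied by zero, so its value does not
matter. -/
theorem eq_sum_of_recursion {D t : ℕ → ℝ} (h : ∀ n, D (n + 1) = t (n + 1) + n * D n) (n : ℕ) :
    D (n + 1) = ∑ i ∈ Finset.range (n + 1),
      (Nat.factorial n : ℝ) / (Nat.factorial (n - i) : ℝ) * t (n + 1 - i) := by
  induction n with
  | zero => simp [h]
  | succ n ih =>
    rw [h, ih, Finset.sum_range_succ' _ (n + 1), Finset.mul_sum, add_comm]
    congr 1
    · refine Finset.sum_congr rfl fun i _ => ?_
      rw [Nat.factorial_succ, Nat.add_sub_add_right, Nat.add_sub_add_right]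
      push_cast
      ring
    · have := Nat.factorial_ne_zero (n + 1)
      simp only [Nat.sub_zero]
      field_simp

/-- The coefficient $k+(l+1)-1$ collects $k$ from $E(x^k\ln x)=kx^k\ln x+x^k$ and $1$ from each of
the $l$ slots where $T$ is restored. -/
theorem decoupledIntegral_fT (hα : 0 ≤ α) (hm : 1 ≤ m) {k : ℝ} (hk : 0 ≤ k) (l : ℕ) :
    decoupledIntegral m α (withT (l + 1) (fT k)) =
      ((k + (l + 1 : ℕ) - 1) * kappa m α (withT (l + 1) (fT k)) +
        kappa m α (withT (l + 1) (fR k))) + l * decoupledIntegral m α (withT l (fT k)) := by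
  rw [decoupledIntegral_withT_succ hα hm (eulerPair_fT hk),
    kappa_withT_linear hα (eulerPair_fT hk).moderate (eulerPair_fR hk).moderate]
  push_cast
  ring

theorem decoupledIntegral_fR (hα : 0 ≤ α) (hm : 1 ≤ m) {k : ℝ} (hk : 0 ≤ k) (l : ℕ) :
    decoupledIntegral m α (withT (l + 1) (fR k)) =
      (k + (l + 1 : ℕ) - 1) * kappa m α (withT (l + 1) (fR k)) +
        l * decoupledIntegral m α (withT l (fR k)) := by
  have h := kappa_withT_linear (m := m) (l := l) hα (eulerPair_fR hk).moderate
    (eulerPair_fR hk).moderate k 0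
  simp only [zero_mul, add_zero] at h
  rw [decoupledIntegral_withT_succ hα hm (eulerPair_fR hk), h]
  push_cast
  ring

end LinearStatistics

theorem corollary1 (m : ℕ) (hm : 1 ≤ m) (α : ℝ) (hα : 0 ≤ α) (k : ℝ) (hk : 0 ≤ k)
    (l : ℕ) (hl : 1 ≤ l) :
    (AllIntegrable m α (withT l (fT k)) ∧ AllIntegrable m α (withT l (fR k))) ∧
    decoupledIntegral m α (withT l (fT k)) =
      ∑ i ∈ Finset.range l, (Nat.factorial (l - 1) : ℝ) / (Nat.factorial (l - 1 - i) : ℝ) *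
        ((k + l - 1 - i) * kappa m α (withT (l - i) (fT k)) +
          kappa m α (withT (l - i) (fR k))) ∧
    decoupledIntegral m α (withT l (fR k)) =
      ∑ i ∈ Finset.range l, (Nat.factorial (l - 1) : ℝ) / (Nat.factorial (l - 1 - i) : ℝ) *
        ((k + l - 1 - i) * kappa m α (withT (l - i) (fR k))) := by
  refine ⟨⟨allIntegrable_withT hα (eulerPair_fT hk), allIntegrable_withT hα (eulerPair_fR hk)⟩,
    ?_, ?_⟩
  · obtain ⟨n, rfl⟩ := Nat.exists_eq_add_of_le' hl
    rw [eq_sum_of_recursion (D := fun l => decoupledIntegral m α (withT l (fT k)))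
      (t := fun l => (k + l - 1) * kappa m α (withT l (fT k)) + kappa m α (withT l (fR k)))
      (decoupledIntegral_fT hα hm hk) n]
    refine Finset.sum_congr rfl fun i hi => ?_
    rw [Nat.add_sub_cancel, Nat.cast_sub (Finset.mem_range.1 hi).le]
    ring
  · obtain ⟨n, rfl⟩ := Nat.exists_eq_add_of_le' hl
    rw [eq_sum_of_recursion (D := fun l => decoupledIntegral m α (withT l (fR k)))
      (t := fun l => (k + l - 1) * kappa m α (withT l (fR k)))
      (decoupledIntegral_fR hα hm hk) n]
    refine Finset.sum_congr rfl fun i hi => ?_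
    rw [Nat.add_sub_cancel, Nat.cast_sub (Finset.mem_range.1 hi).le]
    ring
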